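/- Let $n\ge 4$ be an even integer, let $u\in C^\infty(\mathbb{R}^n)$, and let $g=e^{2u}|dx|^2$ be the corresponding conformal metric on $\mathbb{R}^n$, with scalar curvature $R_g$ and Q-curvature $Q$, where $Q$ is the function determined by $(-\Delta)^{n/2}u=Q\,e^{nu}$. Assume that 1. $g$ is complete; 2. $g$ has finite total Q-curvature, i.e. $Qe^{nu}\in L^1(\mathbb{R}^n)$; 3. $g$ is normal, i.e. there is a constant $C$ such that for all $x\in\mathbb{R}^n$ $$u(x)=\frac{2}{(n-1)!\,|\mathbb{S}^n|}\int_{\mathbb{R}^n}\log\frac{|y|}{|x-y|}\,Q(y)e^{nu(y)}\,dy+C,$$ where $|\mathbb{S}^n|$ is the volume of the standard $n$-sphere; 4. $Q\ge 0$ on $\mathbb{R}^n$. Define the conformal mass of $g$ by $$m_c(g):=\frac{1}{(n-1)(n-2)|\mathbb{S}^{n-1}|}\,\inf_{x\in\mathbb{R}^n}\,\liminf_{r\to\infty}\, r^{3-n}\int_{\partial B_r(x)}R_g\,e^{2u}\,d\sigma\ \in[-\infty,+\infty],$$ where $B_r(x)$ is the Euclidean ball and $d\sigma$ is the Euclidean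 area element on $\partial B_r(x)$. Then $$m_c(g)\ge 0,$$ and $m_c(g)=0$ if and only if $u$ is constant. -/

import Mathlib

open MeasureTheory Filter Topology
open scoped ContDiff Manifold ENNReal

noncomputable section

namespace ConformalMass

/-! ### Riemannian metrics on `ℝⁿ` in the standard coordinates -/

/-- A field of matrices `(g_{ij}(x))` on `ℝⁿ`, the components of a metric tensor in the
standard global chart. -/
abbrev MetricField (n : ℕ) : Type := EuclideanSpace ℝ (Fin n) → Matrix (Fin n) (Fin n) ℝ

/-- The partial derivative `∂_i f (x)`. -/
def partialDeriv {n : ℕ} (i : Fin n) (f : EuclideanSpace ℝ (Fin n) → ℝ)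
    (x : EuclideanSpace ℝ (Fin n)) : ℝ :=
  fderiv ℝ f x (EuclideanSpace.single i 1)

/-- The Christoffel symbol
`Γ^k_{ij} = (1/2) ∑_l g^{kl} (∂_i g_{jl} + ∂_j g_{il} - ∂_l g_{ij})`. -/
def christoffel {n : ℕ} (g : MetricField n) (k i j : Fin n) (x : EuclideanSpace ℝ (Fin n)) : ℝ :=
  (1 / 2) * ∑ l, (g x)⁻¹ k l *
    (partialDeriv i (fun y => g y j l) x + partialDeriv j (fun y => g y i l) x
      - partialDeriv l (fun y => g y i j) x)

/-- The Ricci tensor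
`Ric_{ij} = ∑_k (∂_k Γ^k_{ij} - ∂_j Γ^k_{ik}) + ∑_{k,l} (Γ^k_{kl} Γ^l_{ij} - Γ^k_{jl} Γ^l_{ik})`. -/
def ricci {n : ℕ} (g : MetricField n) (i j : Fin n) (x : EuclideanSpace ℝ (Fin n)) : ℝ :=
  (∑ k, (partialDeriv k (christoffel g k i j) x - partialDeriv j (christoffel g k i k) x))
    + ∑ k, ∑ l, (christoffel g k k l x * christoffel g l i j x
        - christoffel g k j l x * christoffel g l i k x)

/-- The scalar curvature `R_g = ∑_{i,j} g^{ij} Ric_{ij}`. -/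
def scalarCurvature {n : ℕ} (g : MetricField n) (x : EuclideanSpace ℝ (Fin n)) : ℝ :=
  ∑ i, ∑ j, (g x)⁻¹ i j * ricci g i j x

/-- The length `√(g_x(v, v))` of a tangent vector `v` at `x`. -/
def tangentLength {n : ℕ} (g : MetricField n) (x v : EuclideanSpace ℝ (Fin n)) : ℝ :=
  Real.sqrt (∑ i, ∑ j, g x i j * v i * v j)

/-- The Riemannian distance of the metric `g` on `ℝⁿ`: the infimum of the `g`-lengths of the
`C¹` paths from `x` to `y`. -/
def riemDist {n : ℕ} (g : MetricField n) (x y : EuclideanSpace ℝ (Fin n)) : ℝ≥0∞ :=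
  @Manifold.riemannianEDist _ _ _ _ _ 𝓘(ℝ, EuclideanSpace ℝ (Fin n))
    (EuclideanSpace ℝ (Fin n)) _ _
    (fun p => ⟨fun v => ENNReal.ofReal (tangentLength g p v)⟩) x y

/-- The metric `g` is complete: every Cauchy sequence for its Riemannian distance converges for
this distance. -/
def IsCompleteMetric {n : ℕ} (g : MetricField n) : Prop :=
  ∀ s : ℕ → EuclideanSpace ℝ (Fin n),
    (∀ ε : ℝ≥0∞, 0 < ε → ∃ N : ℕ, ∀ k ≥ N, ∀ l ≥ N, riemDist g (s k) (s l) < ε) →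
      ∃ x, Tendsto (fun k => riemDist g (s k) x) atTop (𝓝 0)

/-! ### Conformal metrics -/

/-- The conformal metric `g = e^{2u} |dx|²`. -/
def conformalMetric {n : ℕ} (u : EuclideanSpace ℝ (Fin n) → ℝ) : MetricField n :=
  fun x => Real.exp (2 * u x) • (1 : Matrix (Fin n) (Fin n) ℝ)

/-- The operator `(-Δ)^m` on functions on `ℝⁿ`. -/
def negLaplacianPow {n : ℕ} (m : ℕ) (u : EuclideanSpace ℝ (Fin n) → ℝ) :
    EuclideanSpace ℝ (Fin n) → ℝ :=
  (fun (f : EuclideanSpace ℝ (Fin n) → ℝ) (x : EuclideanSpace ℝ (Fin n)) =>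
    -(Laplacian.laplacian f x))^[m] u

/-- The Q-curvature (of order `n`, for even `n`) of `g = e^{2u} |dx|²`, that is, the function `Q`
with `(-Δ)^{n/2} u = Q e^{nu}`. -/
def qCurvature {n : ℕ} (u : EuclideanSpace ℝ (Fin n) → ℝ) (x : EuclideanSpace ℝ (Fin n)) : ℝ :=
  Real.exp (-(n * u x)) * negLaplacianPow (n / 2) u x

/-- Finite total Q-curvature: `Q e^{nu} ∈ L¹(ℝⁿ)`. -/
def HasFiniteTotalQ {n : ℕ} (u : EuclideanSpace ℝ (Fin n) → ℝ) : Prop :=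
  Integrable (fun y => qCurvature u y * Real.exp (n * u y))

/-- The area of the unit sphere of `ℝᵐ`, so that `|𝕊ⁿ| = unitSphereArea (n + 1)` and
`|𝕊ⁿ⁻¹| = unitSphereArea n`. -/
def unitSphereArea (m : ℕ) : ℝ :=
  (volume : Measure (EuclideanSpace ℝ (Fin m))).toSphere.real Set.univ

/-- The metric `e^{2u} |dx|²` is normal: for some constant `C` and all `x`,
`u(x) = 2 / ((n-1)! |𝕊ⁿ|) ∫ log (|y| / |x-y|) Q(y) e^{nu(y)} dy + C`. -/
def IsNormal {n : ℕ} (u : EuclideanSpace ℝ (Fin n) → ℝ) : Prop :=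
  ∃ C : ℝ, ∀ x, u x = 2 / ((Nat.factorial (n - 1) : ℝ) * unitSphereArea (n + 1)) *
    (∫ y, Real.log (‖y‖ / ‖x - y‖) * (qCurvature u y * Real.exp (n * u y))) + C

/-- The integral `∫_{∂B_r(x)} f dσ` with respect to the Euclidean area element, for `r > 0`
(pulled back to the unit sphere by `θ ↦ x + r θ`). -/
def sphereIntegral {n : ℕ} (f : EuclideanSpace ℝ (Fin n) → ℝ) (x : EuclideanSpace ℝ (Fin n))
    (r : ℝ) : ℝ :=
  r ^ (n - 1) * ∫ θ : Metric.sphere (0 : EuclideanSpace ℝ (Fin n)) 1,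
    f (x + r • (θ : EuclideanSpace ℝ (Fin n)))
      ∂(volume : Measure (EuclideanSpace ℝ (Fin n))).toSphere

/-- The conformal mass of `g = e^{2u} |dx|²`, an extended real number:
`1 / ((n-1)(n-2)|𝕊ⁿ⁻¹|) · inf_x liminf_{r → ∞} r^{3-n} ∫_{∂B_r(x)} R_g e^{2u} dσ`. -/
def conformalMass {n : ℕ} (u : EuclideanSpace ℝ (Fin n) → ℝ) : EReal :=
  ((1 / (((n : ℝ) - 1) * ((n : ℝ) - 2) * unitSphereArea n) : ℝ) : EReal) *
    ⨅ x : EuclideanSpace ℝ (Fin n), liminf (fun r : ℝ =>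
      ((r ^ (3 - (n : ℤ)) * sphereIntegral
        (fun y => scalarCurvature (conformalMetric u) y * Real.exp (2 * u y)) x r : ℝ) : EReal))
      atTop

end ConformalMass

end

/-!
Completeness forces the total mass `α` of the normalized Q-curvature density to be at most `1`:
along every ray the length `∫ e^u` is infinite, whereas for `α > 1` the logarithmic potential
satisfies `u ≤ -(1 + ε) log |x|` at infinity up to a term that Jensen's inequality controls on
average over the directions, so that almost every ray would have finite length.

On the other hand `R_g e^{2u} = -2(n-1) Δu - (n-1)(n-2) |∇u|²`, where `-Δu` is `n - 2` times the
potential of the density for the kernel `|x - y|⁻²`, and by Cauchy–Schwarz `|∇u|²` is at most `α`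
times that same potential. Hence `R_g e^{2u}` is at least `(n-1)(n-2)(2 - α)` times this
potential, which behaves like `α |x|⁻²` at infinity, and the conformal mass is at least
`α (2 - α) ≥ 0`. If the mass vanishes then so does `α`, hence also the density, and `u` is constant.
-/

noncomputable section

namespace ConformalMass

section ScalarCurvature

variable {n : ℕ} {u : EuclideanSpace ℝ (Fin n) → ℝ}

theorem conformalMetric_apply (u : EuclideanSpace ℝ (Fin n) → ℝ) (x : EuclideanSpace ℝ (Fin n))
    (i j : Fin n) :
    conformalMetric u x i j = if i = j then Real.exp (2 * u x) else 0 := by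
  simp [conformalMetric, Matrix.one_apply]

theorem conformalMetric_inv (u : EuclideanSpace ℝ (Fin n) → ℝ) (x : EuclideanSpace ℝ (Fin n)) :
    (conformalMetric u x)⁻¹ = Real.exp (-(2 * u x)) • (1 : Matrix (Fin n) (Fin n) ℝ) :=
  Matrix.inv_eq_left_inv (by simp [conformalMetric, smul_smul, ← Real.exp_add])

theorem conformalMetric_inv_apply (u : EuclideanSpace ℝ (Fin n) → ℝ)
    (x : EuclideanSpace ℝ (Fin n)) (i j : Fin n) :
    (conformalMetric u x)⁻¹ i j = if i = j then Real.exp (-(2 * u x)) else 0 := by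
  simp [conformalMetric_inv, Matrix.one_apply]

theorem partialDeriv_conformalMetric (hu : Differentiable ℝ u) (x : EuclideanSpace ℝ (Fin n))
    (i j l : Fin n) :
    partialDeriv i (fun y => conformalMetric u y j l) x =
      if j = l then 2 * Real.exp (2 * u x) * partialDeriv i u x else 0 := by
  simp only [conformalMetric_apply, partialDeriv]
  split_ifs
  · rw [((hu x).hasFDerivAt.const_mul 2).exp.fderiv]
    simp only [smul_apply, smul_eq_mul]
    ring
  · simp

theorem christoffel_conformalMetric (hu : Differentiable ℝ u) (k i j : Fin n)
    (x : EuclideanSpace ℝ (Fin n)) :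
    christoffel (conformalMetric u) k i j x =
      (if j = k then partialDeriv i u x else 0) + (if i = k then partialDeriv j u x else 0)
        - (if i = j then partialDeriv k u x else 0) := by
  have exp_neg_mul_exp : Real.exp (-(2 * u x)) * Real.exp (2 * u x) = 1 := by
    simp [← Real.exp_add]
  simp only [christoffel, conformalMetric_inv_apply, partialDeriv_conformalMetric hu, ite_mul,
    zero_mul, Finset.sum_ite_eq, Finset.mem_univ, if_true]
  simp only [← mul_ite_zero]
  linear_combination ((if j = k then partialDeriv i u x else 0)
    + (if i = k then partialDeriv j u x else 0)
    - (if i = j then partialDeriv k u x else 0)) * exp_neg_mul_exp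

theorem differentiable_partialDeriv (hu : ContDiff ℝ 2 u) (i : Fin n) :
    Differentiable ℝ (partialDeriv i u) :=
  ((hu.fderiv_right (m := 1) (by norm_num)).differentiable one_ne_zero).clm_apply
    (differentiable_const _)

theorem partialDeriv_christoffel (hu : ContDiff ℝ 2 u) (m k i j : Fin n)
    (x : EuclideanSpace ℝ (Fin n)) :
    partialDeriv m (christoffel (conformalMetric u) k i j) x =
      (if j = k then partialDeriv m (partialDeriv i u) x else 0)
        + (if i = k then partialDeriv m (partialDeriv j u) x else 0)
        - (if i = j then partialDeriv m (partialDeriv k u) x else 0) := by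
  have hasFDerivAt_ite (p : Prop) [Decidable p] (l : Fin n) :
      HasFDerivAt (fun x => if p then partialDeriv l u x else 0)
        (if p then fderiv ℝ (partialDeriv l u) x else 0) x := by
    split_ifs
    · exact (differentiable_partialDeriv hu l x).hasFDerivAt
    · exact hasFDerivAt_const 0 x
  have hderiv := ((hasFDerivAt_ite (j = k) i).add (hasFDerivAt_ite (i = k) j)).sub
    (hasFDerivAt_ite (i = j) k)
  rw [partialDeriv, funext (christoffel_conformalMetric (hu.differentiable two_ne_zero) k i j)]
  refine (DFunLike.congr_fun hderiv.fderiv _).trans ?_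
  simp only [partialDeriv]
  split_ifs <;> simp

theorem sum_partialDeriv_christoffel_sub (hu : ContDiff ℝ 2 u) (i : Fin n)
    (x : EuclideanSpace ℝ (Fin n)) :
    ∑ k, (partialDeriv k (christoffel (conformalMetric u) k i i) x
        - partialDeriv i (christoffel (conformalMetric u) k i k) x) =
      (2 - n) * partialDeriv i (partialDeriv i u) x
        - ∑ k, partialDeriv k (partialDeriv k u) x := by
  have hterm (k : Fin n) : partialDeriv k (christoffel (conformalMetric u) k i i) x
      - partialDeriv i (christoffel (conformalMetric u) k i k) x =
      (if i = k then 2 * partialDeriv k (partialDeriv i u) x else 0)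
        - partialDeriv k (partialDeriv k u) x - partialDeriv i (partialDeriv i u) x := by
    simp only [partialDeriv_christoffel hu]
    split_ifs <;> simp_all
    ring
  simp only [hterm, Finset.sum_sub_distrib, Finset.sum_ite_eq, Finset.mem_univ, if_true,
    Finset.sum_const, Finset.card_univ, Fintype.card_fin, nsmul_eq_mul]
  ring

theorem sum_christoffel_trace_mul (hu : Differentiable ℝ u) (i : Fin n)
    (x : EuclideanSpace ℝ (Fin n)) :
    ∑ k, ∑ l, christoffel (conformalMetric u) k k l x * christoffel (conformalMetric u) l i i x =
      2 * n * partialDeriv i u x ^ 2 - n * ∑ k, partialDeriv k u x ^ 2 := by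
  have hterm (k l : Fin n) :
      christoffel (conformalMetric u) k k l x * christoffel (conformalMetric u) l i i x =
        (if i = l then 2 * partialDeriv i u x ^ 2 else 0) - partialDeriv l u x ^ 2 := by
    simp only [christoffel_conformalMetric hu]
    by_cases hil : i = l <;> by_cases hkl : k = l <;> simp_all [eq_comm] <;> ring
  simp only [hterm, Finset.sum_sub_distrib, Finset.sum_ite_eq, Finset.mem_univ, if_true,
    Finset.sum_const, Finset.card_univ, Fintype.card_fin, nsmul_eq_mul]
  ring

theorem sum_christoffel_mul_christoffel (hu : Differentiable ℝ u) (i : Fin n)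
    (x : EuclideanSpace ℝ (Fin n)) :
    ∑ k, ∑ l, christoffel (conformalMetric u) k i l x * christoffel (conformalMetric u) l i k x =
      (n + 2) * partialDeriv i u x ^ 2 - 2 * ∑ k, partialDeriv k u x ^ 2 := by
  have hterm (k l : Fin n) :
      christoffel (conformalMetric u) k i l x * christoffel (conformalMetric u) l i k x =
        (if l = k then partialDeriv i u x ^ 2 else 0)
          + (if i = k then if i = l then 2 * partialDeriv i u x ^ 2 else 0 else 0)
          - (if i = k then partialDeriv l u x ^ 2 else 0)
          - (if i = l then partialDeriv k u x ^ 2 else 0) := by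
    simp only [christoffel_conformalMetric hu]
    by_cases hil : i = l <;> by_cases hik : i = k <;> by_cases hkl : k = l <;>
      simp_all [eq_comm] <;> ring
  simp only [hterm, Finset.sum_sub_distrib, Finset.sum_add_distrib, Finset.sum_ite_eq,
    Finset.sum_ite_eq', Finset.mem_univ, if_true, Finset.sum_const, Finset.card_univ,
    Fintype.card_fin, nsmul_eq_mul, Finset.sum_ite_irrel, smul_zero]
  ring

theorem ricci_conformalMetric_diag (hu : ContDiff ℝ 2 u) (i : Fin n)
    (x : EuclideanSpace ℝ (Fin n)) :
    ricci (conformalMetric u) i i x =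
      (2 - n) * partialDeriv i (partialDeriv i u) x - ∑ k, partialDeriv k (partialDeriv k u) x
        + (n - 2) * partialDeriv i u x ^ 2 - (n - 2) * ∑ k, partialDeriv k u x ^ 2 := by
  have hu' : Differentiable ℝ u := hu.differentiable two_ne_zero
  simp only [ricci, sum_partialDeriv_christoffel_sub hu, Finset.sum_sub_distrib,
    sum_christoffel_trace_mul hu', sum_christoffel_mul_christoffel hu']
  ring

theorem sum_sq_partialDeriv (u : EuclideanSpace ℝ (Fin n) → ℝ) (x : EuclideanSpace ℝ (Fin n)) :
    ∑ k, partialDeriv k u x ^ 2 = ‖fderiv ℝ u x‖ ^ 2 := by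
  rw [← (InnerProductSpace.toDual ℝ _).symm.norm_map,
    ← (EuclideanSpace.basisFun (Fin n) ℝ).sum_sq_inner_left]
  simp [partialDeriv]

theorem sum_partialDeriv_partialDeriv (hu : ContDiff ℝ 2 u) (x : EuclideanSpace ℝ (Fin n)) :
    ∑ k, partialDeriv k (partialDeriv k u) x = Laplacian.laplacian u x := by
  have hdiff : DifferentiableAt ℝ (fderiv ℝ u) x :=
    (hu.fderiv_right (m := 1) (by norm_num)).differentiable one_ne_zero x
  rw [InnerProductSpace.laplacian_eq_iteratedFDeriv_orthonormalBasis u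
    (EuclideanSpace.basisFun (Fin n) ℝ)]
  refine Finset.sum_congr rfl fun k _ => ?_
  unfold partialDeriv
  simp [iteratedFDeriv_two_apply, fderiv_clm_apply hdiff (differentiableAt_const _)]

theorem scalarCurvature_conformalMetric_mul_exp (hu : ContDiff ℝ 2 u)
    (x : EuclideanSpace ℝ (Fin n)) :
    scalarCurvature (conformalMetric u) x * Real.exp (2 * u x) =
      -(2 * (n - 1)) * Laplacian.laplacian u x - (n - 1) * (n - 2) * ‖fderiv ℝ u x‖ ^ 2 := by
  have exp_neg_mul_exp : Real.exp (-(2 * u x)) * Real.exp (2 * u x) = 1 := by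
    simp [← Real.exp_add]
  have htrace : scalarCurvature (conformalMetric u) x =
      Real.exp (-(2 * u x)) * ∑ i, ricci (conformalMetric u) i i x := by
    simp [scalarCurvature, conformalMetric_inv_apply, Finset.mul_sum]
  rw [htrace, mul_right_comm, exp_neg_mul_exp, one_mul]
  simp only [ricci_conformalMetric_diag hu, Finset.sum_sub_distrib, Finset.sum_add_distrib,
    ← Finset.mul_sum, Finset.sum_const, Finset.card_univ, Fintype.card_fin, nsmul_eq_mul,
    sum_sq_partialDeriv, sum_partialDeriv_partialDeriv hu]
  ring

end ScalarCurvature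

theorem continuous_convolution_of_hasCompactSupport_right {E F : Type*} [NormedAddCommGroup E]
    [NormedSpace ℝ E] [FiniteDimensional ℝ E] [MeasurableSpace E] [BorelSpace E]
    [NormedAddCommGroup F] [NormedSpace ℝ F] {μ : Measure E} [μ.IsAddHaarMeasure] {f : E → ℝ}
    {g : E → F} (hf : Continuous f) (hg : LocallyIntegrable g μ) (hg_supp : HasCompactSupport g) :
    Continuous (convolution f g (ContinuousLinearMap.lsmul ℝ ℝ) μ) := by
  refine continuous_iff_continuousAt.2 fun x₀ => ?_
  obtain ⟨R, hR, hsupp⟩ := hg_supp.isCompact.isBounded.subset_closedBall_lt 0 0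
  let χ : ContDiffBump x₀ := ⟨R + 1, R + 2, by positivity, by linarith⟩
  have hcutoff : Continuous (convolution (fun y => χ y • f y) g (.lsmul ℝ ℝ) μ) :=
    χ.hasCompactSupport.smul_right.continuous_convolution_left _ (χ.continuous.smul hf) hg
  refine hcutoff.continuousAt.congr ?_
  filter_upwards [Metric.ball_mem_nhds x₀ one_pos] with x hx
  refine integral_congr_ae (Eventually.of_forall fun y => ?_)
  by_cases hy : x - y ∈ Metric.closedBall 0 R
  · have hyχ : y ∈ Metric.closedBall x₀ (R + 1) := by
      rw [mem_closedBall_zero_iff, ← dist_eq_norm'] at hy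
      exact (dist_triangle y x x₀).trans (add_le_add hy (Metric.mem_ball.1 hx).le)
    simp [χ.one_of_mem_closedBall hyχ]
  · simp [image_eq_zero_of_notMem_tsupport fun h => hy (hsupp h)]

section SingularKernel

variable {E F : Type*} [NormedAddCommGroup E] [NormedAddCommGroup F]

/-- A kernel with a singularity of order `p` at the origin, whose convolution with a continuous
integrable density makes sense when `p` is less than the dimension. The value at `0` is
irrelevant, so it is left unconstrained. -/
structure IsSingularKernel (p : ℝ) (k : E → F) : Prop where
  continuousOn : ContinuousOn k {0}ᶜ
  exists_norm_le : ∃ M, ∀ z ≠ 0, ‖k z‖ ≤ M * ‖z‖ ^ (-p)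

namespace IsSingularKernel

variable {p : ℝ} {k : E → F}

theorem norm (hk : IsSingularKernel p k) : IsSingularKernel p fun z => ‖k z‖ where
  continuousOn := hk.continuousOn.norm
  exists_norm_le := by simpa using hk.exists_norm_le

theorem stronglyMeasurable [SecondCountableTopology E] [MeasurableSpace E] [BorelSpace E]
    (hk : IsSingularKernel p k) : StronglyMeasurable k := by
  borelize F
  refine stronglyMeasurable_iff_measurable_separable.2
    ⟨measurable_of_continuousOn_compl_singleton 0 hk.continuousOn, ?_⟩
  have himage : TopologicalSpace.IsSeparable (k '' {0}ᶜ) := by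
    rw [← Set.range_domRestrict]
    exact TopologicalSpace.isSeparable_range hk.continuousOn.domRestrict
  have hrange : Set.range k = k '' {0}ᶜ ∪ {k 0} := by
    rw [← Set.image_singleton (f := k), ← Set.image_union, Set.compl_union_self, Set.image_univ]
  rw [hrange]
  exact himage.union (Set.finite_singleton _).isSeparable

section Cutoff

variable [NormedSpace ℝ F] {χ : E → ℝ}

theorem continuous_one_sub_smul (hk : IsSingularKernel p k) (hχ : Continuous χ)
    (hχ₀ : χ =ᶠ[𝓝 0] 1) : Continuous fun z => (1 - χ z) • k z := by
  refine continuous_iff_continuousAt.2 fun z => ?_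
  by_cases hz : z = 0
  · subst hz
    refine continuousAt_const (y := (0 : F)) |>.congr ?_
    filter_upwards [hχ₀] with y hy
    simp [hy]
  · exact (continuous_const.sub hχ).continuousAt.smul
      (hk.continuousOn.continuousAt (isOpen_compl_singleton.mem_nhds hz))

theorem exists_norm_one_sub_smul_le (hk : IsSingularKernel p k) (hp₀ : 0 ≤ p)
    (hχ : ∀ z, χ z ∈ Set.Icc 0 1) (hχ₀ : χ =ᶠ[𝓝 0] 1) : ∃ M, ∀ z, ‖(1 - χ z) • k z‖ ≤ M := by
  obtain ⟨M, hM⟩ := hk.exists_norm_le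
  obtain ⟨ε, hε, hball⟩ := Metric.eventually_nhds_iff.1 hχ₀
  refine ⟨|M| * ε ^ (-p), fun z => ?_⟩
  by_cases hz : dist z 0 < ε
  · simp only [hball hz, Pi.one_apply, sub_self, zero_smul, norm_zero]
    positivity
  rw [dist_zero_right, not_lt] at hz
  have hχz : |1 - χ z| ≤ 1 := abs_le.2 ⟨by linarith [(hχ z).2], by linarith [(hχ z).1]⟩
  calc ‖(1 - χ z) • k z‖ ≤ ‖k z‖ := by
        rw [norm_smul]
        exact mul_le_of_le_one_left (norm_nonneg _) hχz
    _ ≤ M * ‖z‖ ^ (-p) := hM z (norm_pos_iff.1 (hε.trans_le hz))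
    _ ≤ |M| * ε ^ (-p) := mul_le_mul (le_abs_self M)
        (Real.rpow_le_rpow_of_nonpos hε hz (neg_nonpos.2 hp₀)) (by positivity) (abs_nonneg M)

end Cutoff

variable [NormedSpace ℝ E] [FiniteDimensional ℝ E] [MeasurableSpace E] [BorelSpace E]
  {μ : Measure E} [μ.IsAddHaarMeasure]

theorem locallyIntegrable (hk : IsSingularKernel p k) (hp₀ : 0 ≤ p)
    (hp : p < Module.finrank ℝ E) : LocallyIntegrable k μ := by
  obtain ⟨M, hM⟩ := hk.exists_norm_le
  have hdim : 1 ≤ Module.finrank ℝ E := Nat.cast_pos.1 (hp₀.trans_lt hp)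
  have : Nontrivial E := Module.nontrivial_of_finrank_pos (R := ℝ) hdim
  refine locallyIntegrable_of_norm_le_rpow hdim hp (C := M) ?_
    hk.stronglyMeasurable.aestronglyMeasurable
  filter_upwards [μ.ae_ne 0] with z hz using hM z hz

variable [NormedSpace ℝ F] {f : E → ℝ}

theorem convolutionExists_and_continuous (hk : IsSingularKernel p k) (hp₀ : 0 ≤ p)
    (hp : p < Module.finrank ℝ E) (hf : Continuous f) (hfi : Integrable f μ) :
    ConvolutionExists f k (ContinuousLinearMap.lsmul ℝ ℝ) μ ∧
      Continuous (convolution f k (ContinuousLinearMap.lsmul ℝ ℝ) μ) := by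
  let χ : ContDiffBump (0 : E) := ⟨1, 2, one_pos, one_lt_two⟩
  have hfar_cont := hk.continuous_one_sub_smul χ.continuous χ.eventuallyEq_one
  obtain ⟨M, hM⟩ := hk.exists_norm_one_sub_smul_le hp₀ (fun _ => ⟨χ.nonneg, χ.le_one⟩)
    χ.eventuallyEq_one
  have hfar_bdd : BddAbove (Set.range fun z => ‖(1 - χ z) • k z‖) :=
    ⟨M, Set.forall_mem_range.2 hM⟩
  have hnear_supp : HasCompactSupport fun z => χ z • k z := χ.hasCompactSupport.smul_right
  have hnear_int : LocallyIntegrable (fun z => χ z • k z) μ :=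
    ((hk.locallyIntegrable hp₀ hp).integrable_smul_left_of_hasCompactSupport
      χ.continuous χ.hasCompactSupport).locallyIntegrable
  have hnear : ConvolutionExists f (fun z => χ z • k z) (.lsmul ℝ ℝ) μ :=
    hnear_supp.convolutionExists_right_of_continuous_left _ hf hnear_int
  have hfar : ConvolutionExists f (fun z => (1 - χ z) • k z) (.lsmul ℝ ℝ) μ :=
    fun x => BddAbove.convolutionExistsAt _ (s := Set.univ) (by simpa using hfar_bdd)
      MeasurableSet.univ (Set.subset_univ _) hfi.integrableOn hfar_cont.aestronglyMeasurable
  have hsplit : k = (fun z => χ z • k z) + fun z => (1 - χ z) • k z := by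
    ext z
    simp [← add_smul]
  rw [hsplit]
  refine ⟨fun x => ((hnear x).integrable.add (hfar x).integrable).congr <|
    Eventually.of_forall fun y => ((ContinuousLinearMap.lsmul ℝ ℝ (f y)).map_add _ _).symm, ?_⟩
  rw [hnear.distrib_add hfar]
  exact (continuous_convolution_of_hasCompactSupport_right hf hnear_int hnear_supp).add
    (hfar_bdd.continuous_convolution_right_of_integrable _ hfi hfar_cont)

theorem integrable_smul_sub (hk : IsSingularKernel p k) (hp₀ : 0 ≤ p)
    (hp : p < Module.finrank ℝ E) (hf : Continuous f) (hfi : Integrable f μ) (x : E) :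
    Integrable (fun y => f y • k (x - y)) μ :=
  (hk.convolutionExists_and_continuous hp₀ hp hf hfi).1 x

theorem continuous_integral_smul_sub (hk : IsSingularKernel p k) (hp₀ : 0 ≤ p)
    (hp : p < Module.finrank ℝ E) (hf : Continuous f) (hfi : Integrable f μ) :
    Continuous fun x => ∫ y, f y • k (x - y) ∂μ :=
  (hk.convolutionExists_and_continuous hp₀ hp hf hfi).2

end IsSingularKernel

variable [NormedSpace ℝ E] [FiniteDimensional ℝ E] [MeasurableSpace E] [BorelSpace E]
  {μ : Measure E} [μ.IsAddHaarMeasure]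

theorem ae_forall_lineMap_ne (hdim : 2 ≤ Module.finrank ℝ E) (x x' : E) :
    ∀ᵐ y ∂μ, ∀ t : ℝ, AffineMap.lineMap x x' t ≠ y := by
  have hline : line[ℝ, x, x'] ≠ ⊤ := by
    intro htop
    have hcollinear := (collinear_pair ℝ x x').finrank_le_one
    rw [← direction_affineSpan, htop, AffineSubspace.direction_top, finrank_top] at hcollinear
    lia
  filter_upwards [compl_mem_ae_iff.2 (Measure.addHaar_affineSubspace μ _ hline)] with y hy t ht
  exact hy (ht ▸ AffineMap.lineMap_mem_affineSpan_pair t x x')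

variable [NormedSpace ℝ F] {p : ℝ} {k a : E → F} {k' : E → E →L[ℝ] F} {f : E → ℝ}

namespace IsSingularKernel

theorem integrable_segment_prod (hk' : IsSingularKernel p k') (hp₀ : 0 ≤ p)
    (hp : p < Module.finrank ℝ E) (hf : Continuous f) (hfi : Integrable f μ) (x x' : E) :
    Integrable (fun q : ℝ × E => (f q.2 • k' (AffineMap.lineMap x x' q.1 - q.2)) (x' - x))
      ((volume.restrict (Set.uIoc 0 1)).prod μ) := by
  have hmeas : StronglyMeasurable
      fun q : ℝ × E => f q.2 • k' (AffineMap.lineMap x x' q.1 - q.2) :=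
    (hf.stronglyMeasurable.comp_measurable measurable_snd).smul
      (hk'.stronglyMeasurable.comp_measurable
        ((AffineMap.lineMap_continuous.comp continuous_fst).sub continuous_snd).measurable)
  have hcont : Continuous fun t : ℝ =>
      ∫ y, ‖f y • k' (AffineMap.lineMap x x' t - y)‖ ∂μ := by
    simp only [norm_smul, ← smul_eq_mul]
    exact (hk'.norm.continuous_integral_smul_sub hp₀ hp hf.norm hfi.norm).comp
      AffineMap.lineMap_continuous
  exact ((integrable_prod_iff hmeas.aestronglyMeasurable).2
    ⟨ae_of_all _ fun t => hk'.integrable_smul_sub hp₀ hp hf hfi (AffineMap.lineMap x x' t),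
      (hcont.intervalIntegrable 0 1).def'⟩).apply_continuousLinearMap _

variable [CompleteSpace F]

theorem integral_sub_integral_eq_curveIntegral (hk' : IsSingularKernel p k') (hp₀ : 0 ≤ p)
    (hp : p < Module.finrank ℝ E) (hdim : 2 ≤ Module.finrank ℝ E)
    (hf : Continuous f) (hfi : Integrable f μ) (hk : ∀ z ≠ 0, HasFDerivAt k (k' z) z)
    (hint : ∀ x, Integrable (fun y => f y • (k (x - y) + a y)) μ) (x x' : E) :
    (∫ y, f y • (k (x' - y) + a y) ∂μ) - ∫ y, f y • (k (x - y) + a y) ∂μ =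
      ∫ᶜ z in .segment x x', ∫ y, f y • k' (z - y) ∂μ := by
  have hftc : ∀ᵐ y ∂μ, f y • (k (x' - y) + a y) - f y • (k (x - y) + a y) =
      ∫ t in (0 : ℝ)..1, (f y • k' (AffineMap.lineMap x x' t - y)) (x' - x) := by
    filter_upwards [ae_forall_lineMap_ne hdim x x'] with y hy
    have hne (t : ℝ) : AffineMap.lineMap x x' t - y ≠ 0 := sub_ne_zero.2 (hy t)
    have hderiv (t : ℝ) : HasDerivAt (fun t => f y • k (AffineMap.lineMap x x' t - y))
        ((f y • k' (AffineMap.lineMap x x' t - y)) (x' - x)) t :=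
      ((hk _ (hne t)).comp_hasDerivAt t
        (AffineMap.hasDerivAt_lineMap.sub_const y)).const_smul (f y)
    have hcont : Continuous fun t : ℝ => (f y • k' (AffineMap.lineMap x x' t - y)) (x' - x) :=
      ((hk'.continuousOn.comp_continuous (AffineMap.lineMap_continuous.sub continuous_const)
        hne).const_smul (f y)).clm_apply continuous_const
    rw [intervalIntegral.integral_eq_sub_of_hasDerivAt (fun t _ => hderiv t)
      (hcont.intervalIntegrable 0 1)]
    simp [smul_add]
  calc (∫ y, f y • (k (x' - y) + a y) ∂μ) - ∫ y, f y • (k (x - y) + a y) ∂μ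
      = ∫ y, (∫ t in (0 : ℝ)..1, (f y • k' (AffineMap.lineMap x x' t - y)) (x' - x)) ∂μ := by
        rw [← integral_sub (hint x') (hint x), integral_congr_ae hftc]
    _ = ∫ t in (0 : ℝ)..1, ∫ y, (f y • k' (AffineMap.lineMap x x' t - y)) (x' - x) ∂μ :=
        (intervalIntegral_integral_swap
          (hk'.integrable_segment_prod hp₀ hp hf hfi x x')).symm
    _ = ∫ᶜ z in .segment x x', ∫ y, f y • k' (z - y) ∂μ := by
        rw [curveIntegral_segment]
        refine intervalIntegral.integral_congr fun t _ => ?_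
        exact (ContinuousLinearMap.integral_apply (hk'.integrable_smul_sub hp₀ hp hf hfi _) _).symm

theorem hasFDerivAt_integral (hk' : IsSingularKernel p k') (hp₀ : 0 ≤ p)
    (hp : p < Module.finrank ℝ E) (hdim : 2 ≤ Module.finrank ℝ E)
    (hf : Continuous f) (hfi : Integrable f μ) (hk : ∀ z ≠ 0, HasFDerivAt k (k' z) z)
    (hint : ∀ x, Integrable (fun y => f y • (k (x - y) + a y)) μ) (x : E) :
    HasFDerivAt (fun x => ∫ y, f y • (k (x - y) + a y) ∂μ) (∫ y, f y • k' (x - y) ∂μ) x := by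
  have hsegment : HasFDerivAt (∫ᶜ z in .segment x ·, ∫ y, f y • k' (z - y) ∂μ)
      (∫ y, f y • k' (x - y) ∂μ) x :=
    .curveIntegral_segment_source (hk'.continuous_integral_smul_sub hp₀ hp hf hfi)
  refine (hsegment.const_add (∫ y, f y • (k (x - y) + a y) ∂μ)).congr_of_eventuallyEq
    (Eventually.of_forall fun x' => ?_)
  simp only [← hk'.integral_sub_integral_eq_curveIntegral hp₀ hp hdim hf hfi hk hint,
    add_sub_cancel]

end IsSingularKernel

end SingularKernel

section LogPotential

variable {E : Type*} [NormedAddCommGroup E]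

/-- The logarithmic potential of the density `f`, normalized so as to vanish at the origin. -/
def logPotential [MeasurableSpace E] (μ : Measure E) (f : E → ℝ) (x : E) : ℝ :=
  ∫ y, Real.log (‖y‖ / ‖x - y‖) * f y ∂μ

theorem isSingularKernel_posLog_norm_inv :
    IsSingularKernel 1 fun z : E => Real.posLog ‖z‖⁻¹ where
  continuousOn := Real.continuous_posLog.comp_continuousOn
    (continuousOn_id.norm.inv₀ fun _ hz => norm_ne_zero_iff.2 hz)
  exists_norm_le := by
    refine ⟨1, fun z _ => ?_⟩
    rw [Real.norm_of_nonneg Real.posLog_nonneg, one_mul, Real.rpow_neg_one]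
    exact max_le (by positivity) (Real.log_le_self (by positivity))

theorem isSingularKernel_inv_norm_sq : IsSingularKernel 2 fun z : E => (‖z‖ ^ 2)⁻¹ where
  continuousOn := (continuousOn_id.norm.pow 2).inv₀ fun _ hz =>
    pow_ne_zero 2 (norm_ne_zero_iff.2 hz)
  exists_norm_le := ⟨1, fun z _ => by simp⟩

theorem abs_posLog_norm_sub_posLog_norm_le (x y : E) :
    |Real.posLog ‖y‖ - Real.posLog ‖x - y‖| ≤ Real.log 2 + Real.posLog ‖x‖ := by
  have hy := Real.posLog_norm_add_le x (y - x)
  have hxy := Real.posLog_norm_add_le x (-y)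
  rw [add_sub_cancel, norm_sub_rev] at hy
  rw [← sub_eq_add_neg, norm_neg] at hxy
  exact abs_le.2 ⟨by linarith, by linarith⟩

theorem log_norm_div_norm_sub {x y : E} (hy : y ≠ 0) (hxy : y ≠ x) :
    Real.log (‖y‖ / ‖x - y‖) = Real.posLog ‖x - y‖⁻¹ - Real.posLog ‖y‖⁻¹ +
      (Real.posLog ‖y‖ - Real.posLog ‖x - y‖) := by
  rw [Real.log_div (norm_ne_zero_iff.2 hy) (norm_ne_zero_iff.2 (sub_ne_zero.2 hxy.symm)),
    ← Real.posLog_sub_posLog_inv, ← Real.posLog_sub_posLog_inv]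
  ring

variable [NormedSpace ℝ E] [FiniteDimensional ℝ E] [MeasurableSpace E] [BorelSpace E]
  {μ : Measure E} [μ.IsAddHaarMeasure] {f : E → ℝ}

theorem integrable_log_mul (hdim : 2 ≤ Module.finrank ℝ E) (hf : Continuous f)
    (hfi : Integrable f μ) (x : E) :
    Integrable (fun y => Real.log (‖y‖ / ‖x - y‖) * f y) μ := by
  have : Nontrivial E := Module.nontrivial_of_finrank_pos (R := ℝ) (by lia)
  have hsing (x : E) : Integrable (fun y => Real.posLog ‖x - y‖⁻¹ * f y) μ := by
    simpa only [smul_eq_mul, mul_comm] using isSingularKernel_posLog_norm_inv.integrable_smul_sub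
      zero_le_one (by exact_mod_cast hdim) hf hfi x
  have hsing₀ : Integrable (fun y => Real.posLog ‖y‖⁻¹ * f y) μ := by simpa using hsing 0
  have hbdd : Integrable (fun y => (Real.posLog ‖y‖ - Real.posLog ‖x - y‖) * f y) μ :=
    hfi.bdd_mul (by fun_prop) (ae_of_all _ (abs_posLog_norm_sub_posLog_norm_le x))
  refine (((hsing x).sub hsing₀).add hbdd).congr ?_
  filter_upwards [μ.ae_ne 0, μ.ae_ne x] with y hy hxy
  simp only [log_norm_div_norm_sub hy hxy, Pi.add_apply, Pi.sub_apply]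
  ring

end LogPotential

theorem sq_integral_mul_le {α : Type*} [MeasurableSpace α] {ν : Measure α} {f w : α → ℝ}
    (hf₀ : ∀ x, 0 ≤ f x) (hf : Integrable f ν) (hw : Integrable (fun x => f x * w x) ν)
    (hw₂ : Integrable (fun x => f x * w x ^ 2) ν) :
    (∫ x, f x * w x ∂ν) ^ 2 ≤ (∫ x, f x ∂ν) * ∫ x, f x * w x ^ 2 ∂ν := by
  have hquadratic (t : ℝ) : 0 ≤ (∫ x, f x ∂ν) * (t * t) + (-2 * ∫ x, f x * w x ∂ν) * t +
      ∫ x, f x * w x ^ 2 ∂ν := by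
    calc 0 ≤ ∫ x, f x * (t - w x) ^ 2 ∂ν :=
          integral_nonneg fun x => mul_nonneg (hf₀ x) (sq_nonneg _)
      _ = ∫ x, f x * (t * t) + -2 * (f x * w x) * t + f x * w x ^ 2 ∂ν :=
          integral_congr_ae (ae_of_all _ fun x => by ring)
      _ = _ := by
          have hlinear : Integrable (fun x => f x * (t * t) + -2 * (f x * w x) * t) ν :=
            (hf.mul_const _).add ((hw.const_mul _).mul_const _)
          rw [integral_add hlinear hw₂, integral_add (hf.mul_const _)
            ((hw.const_mul _).mul_const _), integral_mul_const, integral_mul_const,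
            integral_const_mul]
  have hdiscrim := discrim_le_zero hquadratic
  rw [discrim] at hdiscrim
  linarith

section LogPotentialDerivatives

-- Instance search finds the norm on `E →L[ℝ] E →L[ℝ] ℝ` only beyond the default depth.
set_option maxSynthPendingDepth 3

variable {E : Type*} [NormedAddCommGroup E] [InnerProductSpace ℝ E]

/-- The inner product of a real space as a bilinear map; the type of `innerSL ℝ` only records that
it is conjugate-linear in its first argument. -/
def realInnerSL : E →L[ℝ] E →L[ℝ] ℝ :=
  innerSL ℝ

theorem realInnerSL_apply (z w : E) : realInnerSL z w = inner ℝ z w := rfl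

theorem norm_realInnerSL (z : E) : ‖realInnerSL z‖ = ‖z‖ :=
  innerSL_apply_norm ℝ z

theorem norm_realInnerSL_le : ‖(realInnerSL : E →L[ℝ] E →L[ℝ] ℝ)‖ ≤ 1 :=
  norm_innerSL_le ℝ

/-- The differential of `z ↦ -log ‖z‖`. -/
def logKernelDeriv (z : E) : E →L[ℝ] ℝ :=
  -((‖z‖ ^ 2)⁻¹ • realInnerSL z)

/-- The second differential of `z ↦ -log ‖z‖`. -/
def logKernelHessian (z : E) : E →L[ℝ] E →L[ℝ] ℝ :=
  (2 * ((‖z‖ ^ 2)⁻¹) ^ 2) • (realInnerSL z).smulRight (realInnerSL z) - (‖z‖ ^ 2)⁻¹ • realInnerSL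

theorem hasFDerivAt_neg_log_norm {z : E} (hz : z ≠ 0) :
    HasFDerivAt (fun z => -Real.log ‖z‖) (logKernelDeriv z) z := by
  have hlog := (((hasStrictFDerivAt_norm_sq z).hasFDerivAt.log
    (pow_ne_zero 2 (norm_ne_zero_iff.2 hz))).const_mul (-(1 / 2)))
  refine (hlog.congr_fderiv ?_).congr_of_eventuallyEq (Eventually.of_forall fun y => ?_)
  · ext v
    simp only [one_div, neg_smul, neg_apply, smul_apply, coe_innerSL_apply, nsmul_eq_mul,
      Nat.cast_ofNat, smul_eq_mul, logKernelDeriv, realInnerSL_apply, neg_inj]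
    ring
  · simp only [Real.log_pow]
    push_cast
    ring

theorem hasFDerivAt_logKernelDeriv {z : E} (hz : z ≠ 0) :
    HasFDerivAt logKernelDeriv (logKernelHessian z) z := by
  have hinv := (hasDerivAt_inv (pow_ne_zero 2 (norm_ne_zero_iff.2 hz))).comp_hasFDerivAt z
    (hasStrictFDerivAt_norm_sq z).hasFDerivAt
  refine (hinv.smul realInnerSL.hasFDerivAt).neg.congr_fderiv ?_
  ext v w
  simp only [Function.comp_apply, neg_smul, neg_add_rev, add_apply, neg_apply,
    ContinuousLinearMap.smulRight_apply, smul_apply, coe_innerSL_apply, nsmul_eq_mul,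
    Nat.cast_ofNat, smul_eq_mul, neg_neg, realInnerSL_apply, logKernelHessian, inv_pow, sub_apply]
  ring

theorem norm_logKernelDeriv (z : E) : ‖logKernelDeriv z‖ = ‖z‖⁻¹ := by
  rw [logKernelDeriv, norm_neg, norm_smul, norm_realInnerSL, norm_inv, norm_pow, norm_norm]
  by_cases hz : ‖z‖ = 0
  · simp [hz]
  · field_simp

theorem norm_logKernelHessian_le (z : E) : ‖logKernelHessian z‖ ≤ 3 * (‖z‖ ^ 2)⁻¹ := by
  have hrankOne : ‖(2 * ((‖z‖ ^ 2)⁻¹) ^ 2) • (realInnerSL z).smulRight (realInnerSL z)‖ ≤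
      2 * (‖z‖ ^ 2)⁻¹ := by
    rw [norm_smul, ContinuousLinearMap.norm_smulRight_apply, norm_realInnerSL,
      Real.norm_of_nonneg (by positivity)]
    by_cases hz : ‖z‖ = 0
    · simp [hz]
    · exact le_of_eq (by field_simp)
  have hscalar : ‖(‖z‖ ^ 2)⁻¹ • (realInnerSL : E →L[ℝ] E →L[ℝ] ℝ)‖ ≤ (‖z‖ ^ 2)⁻¹ := by
    rw [norm_smul, Real.norm_of_nonneg (by positivity)]
    exact mul_le_of_le_one_right (by positivity) norm_realInnerSL_le
  calc ‖logKernelHessian z‖ ≤ 2 * (‖z‖ ^ 2)⁻¹ + (‖z‖ ^ 2)⁻¹ :=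
        (norm_sub_le _ _).trans (add_le_add hrankOne hscalar)
    _ = 3 * (‖z‖ ^ 2)⁻¹ := by ring

theorem isSingularKernel_logKernelDeriv : IsSingularKernel 1 (logKernelDeriv (E := E)) where
  continuousOn z hz := (hasFDerivAt_logKernelDeriv hz).continuousAt.continuousWithinAt
  exists_norm_le := ⟨1, fun z _ => by simp [norm_logKernelDeriv, Real.rpow_neg_one]⟩

theorem isSingularKernel_logKernelHessian : IsSingularKernel 2 (logKernelHessian (E := E)) where
  continuousOn := by
    have hinv := (isSingularKernel_inv_norm_sq (E := E)).continuousOn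
    have hrankOne : Continuous fun z : E => (realInnerSL z).smulRight (realInnerSL z) :=
      (ContinuousLinearMap.smulRightL ℝ E (E →L[ℝ] ℝ)).continuous₂.comp
        (realInnerSL.continuous.prodMk realInnerSL.continuous)
    exact ((hinv.pow 2).const_smul (2 : ℝ) |>.smul hrankOne.continuousOn).sub
      (hinv.smul continuousOn_const)
  exists_norm_le := ⟨3, fun z _ => by simpa [Real.rpow_neg] using norm_logKernelHessian_le z⟩

theorem sum_logKernelHessian_orthonormalBasis {ι : Type*} [Fintype ι]
    (b : OrthonormalBasis ι ℝ E) (z : E) :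
    ∑ i, logKernelHessian z (b i) (b i) = -((Module.finrank ℝ E - 2) * (‖z‖ ^ 2)⁻¹) := by
  have hdiag (i : ι) : logKernelHessian z (b i) (b i) =
      2 * ((‖z‖ ^ 2)⁻¹) ^ 2 * inner ℝ z (b i) ^ 2 - (‖z‖ ^ 2)⁻¹ := by
    simp [logKernelHessian, realInnerSL_apply, sq]
  simp only [hdiag, Finset.sum_sub_distrib, ← Finset.mul_sum, b.sum_sq_inner_left,
    Finset.sum_const, Finset.card_univ, nsmul_eq_mul, ← Module.finrank_eq_card_basis b.toBasis]
  by_cases hz : ‖z‖ = 0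
  · simp [hz]
  · field_simp
    ring

variable [FiniteDimensional ℝ E] [MeasurableSpace E] [BorelSpace E] {μ : Measure E}
  [μ.IsAddHaarMeasure] {f : E → ℝ}

theorem hasFDerivAt_logPotential (hdim : 2 ≤ Module.finrank ℝ E) (hf : Continuous f)
    (hfi : Integrable f μ) (x : E) :
    HasFDerivAt (logPotential μ f) (∫ y, f y • logKernelDeriv (x - y) ∂μ) x := by
  have : Nontrivial E := Module.nontrivial_of_finrank_pos (R := ℝ) (by lia)
  have hkernel (x : E) : (fun y => Real.log (‖y‖ / ‖x - y‖) * f y) =ᵐ[μ]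
      fun y => f y • (-Real.log ‖x - y‖ + Real.log ‖y‖) := by
    filter_upwards [μ.ae_ne 0, μ.ae_ne x] with y hy hxy
    rw [Real.log_div (norm_ne_zero_iff.2 hy) (norm_ne_zero_iff.2 (sub_ne_zero.2 hxy.symm)),
      smul_eq_mul]
    ring
  refine (isSingularKernel_logKernelDeriv.hasFDerivAt_integral zero_le_one
    (by exact_mod_cast hdim) hdim hf hfi (fun _ => hasFDerivAt_neg_log_norm)
    (fun x => (integrable_log_mul hdim hf hfi x).congr (hkernel x)) x).congr_of_eventuallyEq ?_
  exact Eventually.of_forall fun x => integral_congr_ae (hkernel x)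

theorem hasFDerivAt_fderiv_logPotential (hdim : 3 ≤ Module.finrank ℝ E) (hf : Continuous f)
    (hfi : Integrable f μ) (x : E) :
    HasFDerivAt (fderiv ℝ (logPotential μ f)) (∫ y, f y • logKernelHessian (x - y) ∂μ) x := by
  have hdim₂ : 2 ≤ Module.finrank ℝ E := by lia
  have hint (x : E) : Integrable (fun y => f y • (logKernelDeriv (x - y) + 0)) μ := by
    simpa only [add_zero] using isSingularKernel_logKernelDeriv.integrable_smul_sub zero_le_one
      (by exact_mod_cast hdim₂) hf hfi x
  refine (isSingularKernel_logKernelHessian.hasFDerivAt_integral zero_le_two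
    (by exact_mod_cast hdim) hdim₂ hf hfi (fun _ => hasFDerivAt_logKernelDeriv) hint
    x).congr_of_eventuallyEq (Eventually.of_forall fun x => ?_)
  simp only [(hasFDerivAt_logPotential hdim₂ hf hfi x).fderiv, add_zero]

theorem contDiff_two_logPotential (hdim : 3 ≤ Module.finrank ℝ E) (hf : Continuous f)
    (hfi : Integrable f μ) : ContDiff ℝ 2 (logPotential μ f) := by
  have hfderiv : ContDiff ℝ 1 (fderiv ℝ (logPotential μ f)) :=
    contDiff_one_iff_hasFDerivAt.2 ⟨_,
      isSingularKernel_logKernelHessian.continuous_integral_smul_sub zero_le_two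
        (by exact_mod_cast hdim) hf hfi, hasFDerivAt_fderiv_logPotential hdim hf hfi⟩
  exact contDiff_succ_iff_fderiv.2 ⟨fun x =>
    (hasFDerivAt_logPotential (by lia) hf hfi x).differentiableAt, by simp, hfderiv⟩

theorem laplacian_logPotential (hdim : 3 ≤ Module.finrank ℝ E) (hf : Continuous f)
    (hfi : Integrable f μ) (x : E) :
    Laplacian.laplacian (logPotential μ f) x =
      -((Module.finrank ℝ E - 2) * ∫ y, f y * (‖x - y‖ ^ 2)⁻¹ ∂μ) := by
  have hint := isSingularKernel_logKernelHessian.integrable_smul_sub zero_le_two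
    (by exact_mod_cast hdim) hf hfi x
  have happly (v : E) : (∫ y, f y • logKernelHessian (x - y) ∂μ) v v =
      ∫ y, f y * logKernelHessian (x - y) v v ∂μ := by
    rw [ContinuousLinearMap.integral_apply hint, ContinuousLinearMap.integral_apply
      (hint.apply_continuousLinearMap v)]
    rfl
  have hint₂ (v : E) : Integrable (fun y => f y * logKernelHessian (x - y) v v) μ :=
    (hint.apply_continuousLinearMap v).apply_continuousLinearMap v
  simp only [InnerProductSpace.laplacian_eq_iteratedFDeriv_stdOrthonormalBasis,
    iteratedFDeriv_two_apply, (hasFDerivAt_fderiv_logPotential hdim hf hfi x).fderiv,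
    Matrix.cons_val_zero, Matrix.cons_val_one, happly]
  rw [← integral_finsetSum _ fun i _ => hint₂ _, ← integral_const_mul, ← integral_neg]
  simp only [← Finset.mul_sum, sum_logKernelHessian_orthonormalBasis]
  congr! 2
  ring

theorem norm_fderiv_logPotential_sq_le (hdim : 3 ≤ Module.finrank ℝ E) (hf : Continuous f)
    (hfi : Integrable f μ) (hf₀ : ∀ x, 0 ≤ f x) (x : E) :
    ‖fderiv ℝ (logPotential μ f) x‖ ^ 2 ≤
      (∫ y, f y ∂μ) * ∫ y, f y * (‖x - y‖ ^ 2)⁻¹ ∂μ := by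
  have hdim₂ : 2 ≤ Module.finrank ℝ E := by lia
  have hnorm (y : E) : ‖f y • logKernelDeriv (x - y)‖ = f y * ‖x - y‖⁻¹ := by
    rw [norm_smul, norm_logKernelDeriv, Real.norm_of_nonneg (hf₀ y)]
  have hint : Integrable (fun y => f y * ‖x - y‖⁻¹) μ := by
    simpa only [hnorm] using (isSingularKernel_logKernelDeriv.integrable_smul_sub zero_le_one
      (by exact_mod_cast hdim₂) hf hfi x).norm
  have hint₂ : Integrable (fun y => f y * ‖x - y‖⁻¹ ^ 2) μ := by
    simpa only [inv_pow, smul_eq_mul] using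
      isSingularKernel_inv_norm_sq.integrable_smul_sub zero_le_two (by exact_mod_cast hdim)
        hf hfi x
  calc ‖fderiv ℝ (logPotential μ f) x‖ ^ 2 ≤ (∫ y, f y * ‖x - y‖⁻¹ ∂μ) ^ 2 := by
        rw [(hasFDerivAt_logPotential hdim₂ hf hfi x).fderiv]
        gcongr
        simpa only [hnorm] using norm_integral_le_integral_norm (μ := μ)
          fun y => f y • logKernelDeriv (x - y)
    _ ≤ (∫ y, f y ∂μ) * ∫ y, f y * (‖x - y‖ ^ 2)⁻¹ ∂μ := by
        simpa only [inv_pow] using sq_integral_mul_le hf₀ hfi hint hint₂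

end LogPotentialDerivatives

section Laplacian

variable {E F : Type*} [NormedAddCommGroup E] [InnerProductSpace ℝ E] [FiniteDimensional ℝ E]
  [NormedAddCommGroup F] [NormedSpace ℝ F]

theorem contDiff_laplacian {m : ℕ∞ω} {f : E → F} (hf : ContDiff ℝ (m + 2) f) :
    ContDiff ℝ m (Laplacian.laplacian f) := by
  rw [InnerProductSpace.laplacian_eq_iteratedFDeriv_stdOrthonormalBasis]
  refine ContDiff.sum fun i _ => ?_
  exact (ContinuousMultilinearMap.apply ℝ (fun _ : Fin 2 => E) F _).contDiff.comp
    (hf.iteratedFDeriv_right (i := 2) le_rfl)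

end Laplacian

section Averages

theorem tendsto_sq_mul_inv_add_sq (a : ℝ) :
    Tendsto (fun r : ℝ => r ^ 2 * ((r + a) ^ 2)⁻¹) atTop (𝓝 1) := by
  have hlim : Tendsto (fun r : ℝ => ((1 + a * r⁻¹) ^ 2)⁻¹) atTop (𝓝 1) := by
    simpa using (((tendsto_inv_atTop_zero.const_mul a).const_add 1).pow 2).inv₀ (by simp)
  refine hlim.congr' ?_
  filter_upwards [eventually_ne_atTop 0] with r hr
  rw [show 1 + a * r⁻¹ = r⁻¹ * (r + a) by field_simp, mul_pow, mul_inv, inv_pow, inv_inv]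

variable {E : Type*} [NormedAddCommGroup E] [MeasurableSpace E] [BorelSpace E] {μ : Measure E}
  {f : E → ℝ}

theorem tendsto_sq_mul_integral_inv_sq (hf : Integrable f μ) (x : E) :
    Tendsto (fun r : ℝ => r ^ 2 * ∫ y, f y * ((r + ‖x - y‖) ^ 2)⁻¹ ∂μ) atTop
      (𝓝 (∫ y, f y ∂μ)) := by
  have hmeas (r : ℝ) : Measurable fun y : E => r ^ 2 * ((r + ‖x - y‖) ^ 2)⁻¹ := by fun_prop
  have hle (r : ℝ) (hr : 0 < r) (y : E) : ‖r ^ 2 * ((r + ‖x - y‖) ^ 2)⁻¹‖ ≤ 1 := by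
    rw [Real.norm_of_nonneg (by positivity), ← div_eq_mul_inv]
    exact div_le_one_of_le₀ (by gcongr; linarith [norm_nonneg (x - y)]) (by positivity)
  have hlim : Tendsto (fun r : ℝ => ∫ y, (r ^ 2 * ((r + ‖x - y‖) ^ 2)⁻¹) * f y ∂μ) atTop
      (𝓝 (∫ y, f y ∂μ)) := by
    refine tendsto_integral_filter_of_dominated_convergence (fun y => ‖f y‖)
      (Eventually.of_forall fun r => (hmeas r).aestronglyMeasurable.mul hf.aestronglyMeasurable)
      ?_ hf.norm (ae_of_all _ fun y => ?_)
    · filter_upwards [eventually_gt_atTop 0] with r hr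
      refine ae_of_all _ fun y => ?_
      rw [norm_mul]
      exact mul_le_of_le_one_left (norm_nonneg _) (hle r hr y)
    · simpa using (tendsto_sq_mul_inv_add_sq ‖x - y‖).mul_const (f y)
  refine hlim.congr fun r => ?_
  rw [← integral_const_mul]
  congr! 2
  ring

variable [NormedSpace ℝ E] [FiniteDimensional ℝ E] [μ.IsAddHaarMeasure]

theorem integral_inv_sq_add_norm_le (hdim : 3 ≤ Module.finrank ℝ E) (hf : Continuous f)
    (hfi : Integrable f μ) (hf₀ : ∀ x, 0 ≤ f x) (x : E) {z : E} {r : ℝ} (hr : 0 < r)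
    (hz : ‖z‖ ≤ r) :
    ∫ y, f y * ((r + ‖x - y‖) ^ 2)⁻¹ ∂μ ≤ ∫ y, f y * (‖x + z - y‖ ^ 2)⁻¹ ∂μ := by
  have : Nontrivial E := Module.nontrivial_of_finrank_pos (R := ℝ) (by lia)
  have hbdd : Integrable (fun y => f y * ((r + ‖x - y‖) ^ 2)⁻¹) μ := by
    refine hfi.mul_bdd (c := (r ^ 2)⁻¹) (by fun_prop) (ae_of_all _ fun y => ?_)
    rw [Real.norm_of_nonneg (by positivity)]
    gcongr
    linarith [norm_nonneg (x - y)]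
  have hsing : Integrable (fun y => f y * (‖x + z - y‖ ^ 2)⁻¹) μ :=
    isSingularKernel_inv_norm_sq.integrable_smul_sub zero_le_two (by exact_mod_cast hdim) hf hfi _
  refine integral_mono_ae hbdd hsing ?_
  filter_upwards [μ.ae_ne (x + z)] with y hy
  refine mul_le_mul_of_nonneg_left ?_ (hf₀ y)
  have hpos : 0 < ‖x + z - y‖ := norm_pos_iff.2 (sub_ne_zero.2 hy.symm)
  have hle : ‖x + z - y‖ ≤ r + ‖x - y‖ := by
    rw [add_comm x z, add_sub_assoc]
    exact (norm_add_le z (x - y)).trans (by gcongr)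
  gcongr

end Averages

section ConformalMass

variable {n : ℕ} {f u : EuclideanSpace ℝ (Fin n) → ℝ}

theorem unitSphereArea_pos {m : ℕ} (hm : 0 < m) : 0 < unitSphereArea m := by
  have : Nontrivial (EuclideanSpace ℝ (Fin m)) :=
    Module.nontrivial_of_finrank_pos (R := ℝ) (by simpa)
  exact ENNReal.toReal_pos (Measure.measure_univ_ne_zero.2 (Measure.toSphere_ne_zero _))
    (measure_ne_top _ _)

theorem continuous_scalarCurvature_conformalMetric_mul_exp (hu : ContDiff ℝ 2 u) :
    Continuous fun x => scalarCurvature (conformalMetric u) x * Real.exp (2 * u x) := by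
  simp only [scalarCurvature_conformalMetric_mul_exp hu]
  have hlaplacian : Continuous (Laplacian.laplacian u) :=
    (contDiff_laplacian (m := 0) (by simpa using hu)).continuous
  have hfderiv : Continuous (fderiv ℝ u) := hu.continuous_fderiv two_ne_zero
  fun_prop

theorem contDiff_negLaplacianPow (hu : ContDiff ℝ ∞ u) (m : ℕ) :
    ContDiff ℝ ∞ (negLaplacianPow m u) := by
  induction m with
  | zero => exact hu
  | succ m ih =>
    simp only [negLaplacianPow, Function.iterate_succ_apply']
    exact (contDiff_laplacian (m := ∞) ih).neg

theorem le_sphereIntegral (hu : Continuous u) {a r : ℝ} (hr : 0 ≤ r)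
    (x : EuclideanSpace ℝ (Fin n)) (ha : ∀ z, ‖z‖ = r → a ≤ u (x + z)) :
    r ^ (n - 1) * (unitSphereArea n * a) ≤ sphereIntegral u x r := by
  have hint : Integrable
      (fun θ : Metric.sphere (0 : EuclideanSpace ℝ (Fin n)) 1 => u (x + r • θ.1))
      volume.toSphere :=
    Continuous.integrable_of_hasCompactSupport (by fun_prop) (.of_compactSpace _)
  refine mul_le_mul_of_nonneg_left ?_ (by positivity)
  rw [unitSphereArea, ← smul_eq_mul, ← integral_const]
  refine integral_mono (integrable_const a) hint fun θ => ha _ ?_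
  rw [norm_smul, norm_eq_of_mem_sphere θ, mul_one, Real.norm_of_nonneg hr]

theorem le_conformalMass_of_tendsto (hn : 3 ≤ n) (hu : ContDiff ℝ 2 u) {a : ℝ}
    {b : EuclideanSpace ℝ (Fin n) → ℝ → ℝ}
    (hb : ∀ x r, 0 < r → ∀ z, ‖z‖ = r → (n - 1) * (n - 2) * b x r ≤
      scalarCurvature (conformalMetric u) (x + z) * Real.exp (2 * u (x + z)))
    (hlim : ∀ x, Tendsto (fun r => r ^ 2 * b x r) atTop (𝓝 a)) :
    (a : EReal) ≤ conformalMass u := by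
  have hn' : (3 : ℝ) ≤ n := by exact_mod_cast hn
  have hn_sub_one : (0 : ℝ) < n - 1 := by linarith
  have hn_sub_two : (0 : ℝ) < n - 2 := by linarith
  have harea : 0 < unitSphereArea n := unitSphereArea_pos (by lia)
  set κ : ℝ := (n - 1) * (n - 2) * unitSphereArea n with hκ
  have hκ₀ : 0 < κ := by positivity
  have hscale : (a : EReal) = (1 / κ : ℝ) * (κ * a : ℝ) := by
    rw [← EReal.coe_mul]
    congr 1
    field_simp [hκ₀.ne']
  rw [hscale, conformalMass]
  refine mul_le_mul_of_nonneg_left (le_iInf fun x => ?_) (EReal.coe_nonneg.2 (by positivity))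
  rw [← ((continuous_coe_real_ereal.tendsto _).comp ((hlim x).const_mul κ)).liminf_eq]
  refine liminf_le_liminf ?_
  filter_upwards [eventually_gt_atTop 0] with r hr
  refine EReal.coe_le_coe_iff.2 ?_
  have hpow : r ^ 2 = r ^ (3 - (n : ℤ)) * r ^ (n - 1) := by
    rw [← zpow_natCast r (n - 1), ← zpow_add₀ hr.ne', ← zpow_natCast r 2]
    congr 1
    lia
  calc κ * (r ^ 2 * b x r)
      = r ^ (3 - (n : ℤ)) * (r ^ (n - 1) * (unitSphereArea n *
          ((n - 1) * (n - 2) * b x r))) := by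
        rw [hκ, hpow]
        ring
    _ ≤ _ := mul_le_mul_of_nonneg_left (le_sphereIntegral
        (continuous_scalarCurvature_conformalMetric_mul_exp hu) hr.le x (hb x r hr))
        (by positivity)

theorem conformalMass_const (a : ℝ) :
    conformalMass (fun _ : EuclideanSpace ℝ (Fin n) => a) = 0 := by
  have hflat (x : EuclideanSpace ℝ (Fin n)) :
      scalarCurvature (conformalMetric fun _ => a) x * Real.exp (2 * a) = 0 := by
    rw [scalarCurvature_conformalMetric_mul_exp (u := fun _ => a) contDiff_const]
    simp
  simp [conformalMass, hflat, sphereIntegral]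

theorem le_scalarCurvature_logPotential (hn : 3 ≤ n) (hf : Continuous f) (hfi : Integrable f)
    (hf₀ : ∀ x, 0 ≤ f x) (C : ℝ) (x : EuclideanSpace ℝ (Fin n)) :
    (n - 1) * (n - 2) * ((2 - ∫ y, f y) * ∫ y, f y * (‖x - y‖ ^ 2)⁻¹) ≤
      scalarCurvature (conformalMetric fun x => logPotential volume f x + C) x *
        Real.exp (2 * (logPotential volume f x + C)) := by
  have hdim : 3 ≤ Module.finrank ℝ (EuclideanSpace ℝ (Fin n)) := by simpa using hn
  have hn' : (3 : ℝ) ≤ n := by exact_mod_cast hn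
  have hcontDiff := contDiff_two_logPotential hdim hf hfi
  have hlaplacian : Laplacian.laplacian (fun x => logPotential volume f x + C) x =
      -((n - 2) * ∫ y, f y * (‖x - y‖ ^ 2)⁻¹) := by
    have hadd := hcontDiff.contDiffAt.laplacian_add (x := x) (contDiffAt_const (c := C))
    have hconst : Laplacian.laplacian (fun _ : EuclideanSpace ℝ (Fin n) => C) = 0 :=
      InnerProductSpace.laplacian_const
    rw [hconst, Pi.zero_apply, add_zero, laplacian_logPotential hdim hf hfi,
      finrank_euclideanSpace_fin] at hadd
    exact hadd
  rw [scalarCurvature_conformalMetric_mul_exp (hcontDiff.add contDiff_const), hlaplacian,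
    fderiv_add_const]
  calc (n - 1) * (n - 2) * ((2 - ∫ y, f y) * ∫ y, f y * (‖x - y‖ ^ 2)⁻¹)
      = -(2 * (n - 1)) * -((n - 2) * ∫ y, f y * (‖x - y‖ ^ 2)⁻¹) -
          (n - 1) * (n - 2) * ((∫ y, f y) * ∫ y, f y * (‖x - y‖ ^ 2)⁻¹) := by ring
    _ ≤ _ := sub_le_sub_left (mul_le_mul_of_nonneg_left
        (norm_fderiv_logPotential_sq_le hdim hf hfi hf₀ x)
        (mul_nonneg (by linarith) (by linarith))) _

theorem le_conformalMass_logPotential (hn : 3 ≤ n) (hf : Continuous f) (hfi : Integrable f)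
    (hf₀ : ∀ x, 0 ≤ f x) (hf₂ : ∫ x, f x ≤ 2) (C : ℝ) :
    (((2 - ∫ x, f x) * ∫ x, f x : ℝ) : EReal) ≤
      conformalMass fun x => logPotential volume f x + C := by
  have hn' : (3 : ℝ) ≤ n := by exact_mod_cast hn
  have hdim : 3 ≤ Module.finrank ℝ (EuclideanSpace ℝ (Fin n)) := by simpa using hn
  refine le_conformalMass_of_tendsto hn ((contDiff_two_logPotential hdim hf hfi).add
    contDiff_const) (b := fun x r => (2 - ∫ y, f y) * ∫ y, f y * ((r + ‖x - y‖) ^ 2)⁻¹)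
    (fun x r hr z hz => ?_) fun x => ?_
  · refine le_trans ?_ (le_scalarCurvature_logPotential hn hf hfi hf₀ C (x + z))
    have hcoeff : (0 : ℝ) ≤ (n - 1) * (n - 2) := mul_nonneg (by linarith) (by linarith)
    exact mul_le_mul_of_nonneg_left (mul_le_mul_of_nonneg_left
      (integral_inv_sq_add_norm_le hdim hf hfi hf₀ x hr hz.le) (by linarith)) hcoeff
  · refine ((tendsto_sq_mul_integral_inv_sq hfi x).const_mul (2 - ∫ y, f y)).congr fun r => ?_
    ring

end ConformalMass

section RiemannianDistance

variable {n : ℕ} {u : EuclideanSpace ℝ (Fin n) → ℝ}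

theorem tangentLength_conformalMetric (u : EuclideanSpace ℝ (Fin n) → ℝ)
    (x v : EuclideanSpace ℝ (Fin n)) :
    tangentLength (conformalMetric u) x v = Real.exp (u x) * ‖v‖ := by
  have hsq : ∑ i, ∑ j, conformalMetric u x i j * v i * v j = (Real.exp (u x) * ‖v‖) ^ 2 := by
    simp only [conformalMetric_apply, ite_mul, zero_mul, Finset.sum_ite_eq, Finset.mem_univ,
      if_true]
    rw [mul_pow, EuclideanSpace.real_norm_sq_eq, Finset.mul_sum, ← Real.exp_nat_mul]
    exact Finset.sum_congr rfl fun i _ => by push_cast; ring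
  rw [tangentLength, hsq, Real.sqrt_sq (by positivity)]

/-- The extended norm of `e^{2u} |dx|²` on the tangent spaces, spelled as in the definition of
`riemDist`, so that Mathlib's Riemannian distance can be used with it as a local instance. -/
abbrev conformalENorm (u : EuclideanSpace ℝ (Fin n) → ℝ) (p : EuclideanSpace ℝ (Fin n)) :
    ENorm (TangentSpace 𝓘(ℝ, EuclideanSpace ℝ (Fin n)) p) :=
  ⟨fun v => ENNReal.ofReal (tangentLength (conformalMetric u) p v)⟩

theorem enormSMulClass_conformalENorm (u : EuclideanSpace ℝ (Fin n) → ℝ)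
    (x : EuclideanSpace ℝ (Fin n)) :
    @ENormSMulClass ℝ (TangentSpace 𝓘(ℝ, EuclideanSpace ℝ (Fin n)) x) _
      (conformalENorm u x) _ := by
  have hsmul (r : ℝ) (v : EuclideanSpace ℝ (Fin n)) :
      ENNReal.ofReal (tangentLength (conformalMetric u) x (r • v)) =
        ‖r‖ₑ * ENNReal.ofReal (tangentLength (conformalMetric u) x v) := by
    rw [tangentLength_conformalMetric, tangentLength_conformalMetric, norm_smul, mul_left_comm,
      ENNReal.ofReal_mul (norm_nonneg _), ofReal_norm]
  exact @ENormSMulClass.mk _ _ _ (conformalENorm u x) _ hsmul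

theorem pathELength_conformalENorm (u : EuclideanSpace ℝ (Fin n) → ℝ)
    (γ : ℝ → EuclideanSpace ℝ (Fin n)) (a b : ℝ) :
    @Manifold.pathELength _ _ _ _ _ 𝓘(ℝ, EuclideanSpace ℝ (Fin n))
      (EuclideanSpace ℝ (Fin n)) _ _ (conformalENorm u) γ a b =
      ∫⁻ t in Set.Icc a b, ENNReal.ofReal (Real.exp (u (γ t)) * ‖deriv γ t‖) := by
  rw [@Manifold.pathELength_eq_lintegral_mfderiv_Icc _ _ _ _ _ 𝓘(ℝ, EuclideanSpace ℝ (Fin n))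
    (EuclideanSpace ℝ (Fin n)) _ _ (conformalENorm u)]
  refine lintegral_congr fun t => congrArg ENNReal.ofReal ?_
  rw [mfderiv_eq_fderiv]
  exact tangentLength_conformalMetric u (γ t) (deriv γ t)

theorem riemDist_comm (u : EuclideanSpace ℝ (Fin n) → ℝ) (p q : EuclideanSpace ℝ (Fin n)) :
    riemDist (conformalMetric u) p q = riemDist (conformalMetric u) q p := by
  let _ := conformalENorm u
  have := enormSMulClass_conformalENorm u
  exact Manifold.riemannianEDist_comm

theorem riemDist_le_lintegral (u : EuclideanSpace ℝ (Fin n) → ℝ)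
    {γ : ℝ → EuclideanSpace ℝ (Fin n)} {a b : ℝ} (hab : a ≤ b)
    (hγ : ContDiffOn ℝ 1 γ (Set.Icc a b)) :
    riemDist (conformalMetric u) (γ a) (γ b) ≤
      ∫⁻ t in Set.Icc a b, ENNReal.ofReal (Real.exp (u (γ t)) * ‖deriv γ t‖) := by
  rw [← pathELength_conformalENorm]
  let _ := conformalENorm u
  have := enormSMulClass_conformalENorm u
  exact Manifold.riemannianEDist_le_pathELength (contMDiffOn_iff_contDiffOn.2 hγ) rfl rfl hab

theorem exists_lintegral_lt_of_riemDist_lt {p q : EuclideanSpace ℝ (Fin n)} {r : ℝ≥0∞}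
    (h : riemDist (conformalMetric u) p q < r) :
    ∃ γ : ℝ → EuclideanSpace ℝ (Fin n), γ 0 = p ∧ γ 1 = q ∧ ContDiffOn ℝ 1 γ (Set.Icc 0 1) ∧
      ∫⁻ t in Set.Icc (0 : ℝ) 1, ENNReal.ofReal (Real.exp (u (γ t)) * ‖deriv γ t‖) < r := by
  let _ := conformalENorm u
  obtain ⟨γ, h₀, h₁, hγ, hlength⟩ := Manifold.exists_lt_of_riemannianEDist_lt h
  rw [pathELength_conformalENorm] at hlength
  exact ⟨γ, h₀, h₁, contMDiffOn_iff_contDiffOn.1 hγ, hlength⟩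

section Lipschitz

variable {h : EuclideanSpace ℝ (Fin n) → ℝ} {K : ℝ}

theorem enorm_comp_sub_le_lintegral (hh : ContDiff ℝ 1 h) (hK₀ : 0 ≤ K)
    (hK : ∀ z, ‖fderiv ℝ h z‖ ≤ K * Real.exp (u z)) {γ : ℝ → EuclideanSpace ℝ (Fin n)}
    (hγ : ContDiffOn ℝ 1 γ (Set.Icc 0 1)) :
    ‖h (γ 1) - h (γ 0)‖ₑ ≤ ENNReal.ofReal K *
      ∫⁻ t in Set.Icc (0 : ℝ) 1, ENNReal.ofReal (Real.exp (u (γ t)) * ‖deriv γ t‖) := by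
  refine (enorm_sub_le_lintegral_deriv_of_contDiffOn_Icc (hh.comp_contDiffOn hγ)
    zero_le_one).trans ?_
  rw [← lintegral_const_mul' _ _ ENNReal.ofReal_ne_top, ← restrict_Ioo_eq_restrict_Icc]
  refine setLIntegral_mono' measurableSet_Ioo fun t ht => ?_
  have hγt : DifferentiableAt ℝ γ t :=
    ((hγ t (Set.Ioo_subset_Icc_self ht)).differentiableWithinAt one_ne_zero).differentiableAt
      (Icc_mem_nhds ht.1 ht.2)
  rw [fderiv_comp_deriv t (hh.differentiable one_ne_zero _) hγt, ← ofReal_norm,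
    ← ENNReal.ofReal_mul hK₀, ← mul_assoc]
  exact ENNReal.ofReal_le_ofReal ((fderiv ℝ h (γ t)).le_of_opNorm_le (hK _) _)

theorem enorm_sub_le_mul_riemDist (hh : ContDiff ℝ 1 h) (hK₀ : 0 < K)
    (hK : ∀ z, ‖fderiv ℝ h z‖ ≤ K * Real.exp (u z)) (p q : EuclideanSpace ℝ (Fin n)) :
    ‖h q - h p‖ₑ ≤ ENNReal.ofReal K * riemDist (conformalMetric u) p q := by
  have hK_ne : ENNReal.ofReal K ≠ 0 := by simpa
  refine (ENNReal.div_le_iff' hK_ne ENNReal.ofReal_ne_top).1 (le_of_forall_gt fun r hr => ?_)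
  obtain ⟨γ, rfl, rfl, hγ, hlength⟩ := exists_lintegral_lt_of_riemDist_lt hr
  exact ((ENNReal.div_le_iff' hK_ne ENNReal.ofReal_ne_top).2
    (enorm_comp_sub_le_lintegral hh hK₀.le hK hγ)).trans_lt hlength

theorem exists_norm_fderiv_le_mul_exp (hu : Continuous u) (hh : ContDiff ℝ 1 h)
    (hh_supp : HasCompactSupport h) : ∃ K > 0, ∀ z, ‖fderiv ℝ h z‖ ≤ K * Real.exp (u z) := by
  have hcont : Continuous fun z => Real.exp (-u z) • fderiv ℝ h z :=
    hu.neg.rexp.smul (hh.continuous_fderiv one_ne_zero)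
  have hsupp : HasCompactSupport fun z => Real.exp (-u z) • fderiv ℝ h z :=
    (hh_supp.fderiv ℝ).smul_left (f := fun z => Real.exp (-u z))
  obtain ⟨K, hK⟩ := hsupp.exists_bound_of_continuous hcont
  refine ⟨max K 1, by positivity, fun z => ?_⟩
  have hz := (hK z).trans (le_max_left K 1)
  rwa [norm_smul, Real.norm_of_nonneg (Real.exp_nonneg _), Real.exp_neg,
    inv_mul_le_iff₀' (Real.exp_pos _)] at hz

end Lipschitz

theorem tendsto_of_tendsto_riemDist (hu : Continuous u) {ι : Type*} {l : Filter ι}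
    {s : ι → EuclideanSpace ℝ (Fin n)} {x : EuclideanSpace ℝ (Fin n)}
    (hs : Tendsto (fun k => riemDist (conformalMetric u) (s k) x) l (𝓝 0)) :
    Tendsto s l (𝓝 x) := by
  refine Metric.tendsto_nhds.2 fun ε hε => ?_
  let χ : ContDiffBump x := ⟨ε / 2, ε, by positivity, by linarith⟩
  obtain ⟨K, hK₀, hK⟩ := exists_norm_fderiv_le_mul_exp hu χ.contDiff χ.hasCompactSupport
  have hlim : Tendsto (fun k => ENNReal.ofReal K * riemDist (conformalMetric u) (s k) x) l
      (𝓝 0) := by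
    simpa using ENNReal.Tendsto.const_mul hs (Or.inr ENNReal.ofReal_ne_top)
  filter_upwards [hlim.eventually_lt_const one_pos] with k hk
  by_contra hfar
  have hle := enorm_sub_le_mul_riemDist χ.contDiff hK₀ hK (s k) x
  rw [χ.one_of_mem_closedBall (Metric.mem_closedBall_self χ.rIn_pos.le),
    χ.zero_of_le_dist (not_lt.1 hfar), sub_zero, enorm_one] at hle
  exact hle.not_gt hk

theorem riemDist_smul_smul_le (u : EuclideanSpace ℝ (Fin n) → ℝ)
    {θ : EuclideanSpace ℝ (Fin n)} (hθ : ‖θ‖ = 1) {a b : ℝ} (hab : a ≤ b) :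
    riemDist (conformalMetric u) (a • θ) (b • θ) ≤
      ∫⁻ t in Set.Icc a b, ENNReal.ofReal (Real.exp (u (t • θ))) := by
  have hderiv (t : ℝ) : deriv (fun t : ℝ => t • θ) t = θ := by
    simpa using ((hasDerivAt_id t).smul_const θ).deriv
  have hsmooth : ContDiff ℝ 1 fun t : ℝ => t • θ := by fun_prop
  simpa only [hderiv, hθ, mul_one] using riemDist_le_lintegral u hab hsmooth.contDiffOn

theorem tendsto_lintegral_Ici_zero {F : ℝ → ℝ≥0∞} {R : ℝ}
    (hF : ∫⁻ t in Set.Ioi R, F t ≠ ⊤) :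
    Tendsto (fun T => ∫⁻ t in Set.Ici T, F t) atTop (𝓝 0) := by
  have hfinite : (volume.withDensity F) (Set.Ici (R + 1)) ≠ ⊤ := by
    rw [withDensity_apply _ measurableSet_Ici]
    exact ne_top_of_le_ne_top hF (lintegral_mono_set (Set.Ici_subset_Ioi.2 (lt_add_one R)))
  have hempty : ⋂ T : ℝ, Set.Ici T = ∅ :=
    Set.iInter_eq_empty_iff.2 fun t => ⟨t + 1, by simp⟩
  have hlim := tendsto_measure_iInter_atTop (fun T => measurableSet_Ici.nullMeasurableSet)
    antitone_Ici ⟨R + 1, hfinite⟩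
  rw [hempty, measure_empty] at hlim
  exact hlim.congr fun T => withDensity_apply _ measurableSet_Ici

theorem lintegral_ray_eq_top (hu : Continuous u) (hg : IsCompleteMetric (conformalMetric u))
    {θ : EuclideanSpace ℝ (Fin n)} (hθ : ‖θ‖ = 1) (R : ℝ) :
    ∫⁻ t in Set.Ioi R, ENNReal.ofReal (Real.exp (u (t • θ))) = ⊤ := by
  by_contra hfinite
  have htail := (tendsto_lintegral_Ici_zero hfinite).comp tendsto_natCast_atTop_atTop
  obtain ⟨x, hx⟩ := hg (fun k => (k : ℝ) • θ) fun ε hε => by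
    obtain ⟨N, hN⟩ := (htail.eventually_lt_const hε).exists
    have hle {k l : ℕ} (hk : N ≤ k) (hkl : k ≤ l) :
        riemDist (conformalMetric u) ((k : ℝ) • θ) ((l : ℝ) • θ) < ε := by
      refine ((riemDist_smul_smul_le u hθ (Nat.cast_le.2 hkl)).trans
        (lintegral_mono_set ?_)).trans_lt hN
      exact fun t ht => (Nat.cast_le.2 hk).trans ht.1
    refine ⟨N, fun k hk l hl => ?_⟩
    rcases le_total k l with hkl | hlk
    · exact hle hk hkl
    · exact riemDist_comm u _ _ ▸ hle hl hlk
  have hnorm := (tendsto_of_tendsto_riemDist hu hx).norm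
  simp only [norm_smul, hθ, mul_one, RCLike.norm_natCast] at hnorm
  exact not_tendsto_nhds_of_tendsto_atTop tendsto_natCast_atTop_atTop _ hnorm

end RiemannianDistance

theorem lintegral_eq_lintegral_toSphere {E : Type*} [NormedAddCommGroup E] [NormedSpace ℝ E]
    [FiniteDimensional ℝ E] [Nontrivial E] [MeasurableSpace E] [BorelSpace E] (μ : Measure E)
    [μ.IsAddHaarMeasure] {G : E → ℝ≥0∞} (hG : Measurable G) :
    ∫⁻ x, G x ∂μ = ∫⁻ θ : Metric.sphere (0 : E) 1, (∫⁻ r in Set.Ioi (0 : ℝ),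
      ENNReal.ofReal (r ^ (Module.finrank ℝ E - 1)) * G (r • (θ : E))) ∂μ.toSphere := by
  have hpolar : Measurable fun q : Metric.sphere (0 : E) 1 × Set.Ioi (0 : ℝ) =>
      G ((q.2 : ℝ) • (q.1 : E)) := hG.comp (by fun_prop)
  calc ∫⁻ x, G x ∂μ = ∫⁻ x in {0}ᶜ, G x ∂μ := by rw [restrict_compl_singleton]
    _ = ∫⁻ x : ({0}ᶜ : Set E), G x ∂(μ.comap Subtype.val) :=
      (lintegral_subtype_comap (measurableSet_singleton _).compl G).symm
    _ = ∫⁻ q, G ((q.2 : ℝ) • (q.1 : E))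
          ∂(μ.toSphere.prod (Measure.volumeIoiPow (Module.finrank ℝ E - 1))) := by
      rw [← μ.measurePreserving_homeomorphUnitSphereProd.lintegral_comp hpolar]
      refine lintegral_congr fun x => ?_
      have hx : ‖(x : E)‖ ≠ 0 := norm_ne_zero_iff.2 x.2
      simp [smul_smul, hx]
    _ = _ := by
      rw [lintegral_prod _ hpolar.aemeasurable]
      refine lintegral_congr fun θ => ?_
      have hray : Measurable fun r : ℝ => G (r • (θ : E)) := hG.comp (by fun_prop)
      exact (lintegral_withDensity_eq_lintegral_mul _ (by fun_prop)
        (hray.comp measurable_subtype_coe)).trans (lintegral_subtype_comap measurableSet_Ioi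
          fun r : ℝ => ENNReal.ofReal (r ^ (Module.finrank ℝ E - 1)) * G (r • (θ : E)))

-- Jensen's inequality, applied to `w` completed to a probability measure by an atom where `ψ = 0`.
theorem exp_integral_mul_le {Ω : Type*} [MeasurableSpace Ω] {ν : Measure Ω} {ψ w : Ω → ℝ}
    (hw₀ : ∀ y, 0 ≤ w y) (hw : Integrable w ν) (hw₁ : ∫ y, w y ∂ν ≤ 1)
    (hψ : Integrable (fun y => w y * ψ y) ν)
    (hexp : Integrable (fun y => w y * (Real.exp (ψ y) - 1)) ν) :
    Real.exp (∫ y, w y * ψ y ∂ν) ≤ 1 + ∫ y, w y * (Real.exp (ψ y) - 1) ∂ν := by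
  set I := ∫ y, w y * ψ y ∂ν with hI
  have htangent (s : ℝ) : Real.exp I * (s - I + 1) ≤ Real.exp s := by
    have h := mul_le_mul_of_nonneg_left (Real.add_one_le_exp (s - I)) (Real.exp_pos I).le
    rwa [← Real.exp_add, add_sub_cancel] at h
  have hle : Real.exp I * I + (Real.exp I * (1 - I) - 1) * ∫ y, w y ∂ν ≤
      ∫ y, w y * (Real.exp (ψ y) - 1) ∂ν := by
    rw [hI, ← integral_const_mul, ← integral_const_mul,
      ← integral_add (hψ.const_mul _) (hw.const_mul _)]
    refine integral_mono ((hψ.const_mul _).add (hw.const_mul _)) hexp fun y => ?_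
    simp only [← hI]
    linear_combination mul_le_mul_of_nonneg_left (htangent (ψ y)) (hw₀ y)
  have hzero := htangent 0
  rw [Real.exp_zero] at hzero
  linear_combination hle + mul_le_mul_of_nonneg_left hzero (sub_nonneg.2 hw₁)

section TruncatedKernel

variable {E : Type*} [NormedAddCommGroup E]

theorem exp_posLog_of_nonneg {t : ℝ} (ht : 0 ≤ t) : Real.exp (Real.posLog t) = max 1 t := by
  rw [Real.posLog_eq_log_max_one ht, Real.exp_log (by positivity)]

theorem isSingularKernel_exp_posLog_norm_inv_sub_one :
    IsSingularKernel 1 fun z : E => Real.exp (Real.posLog ‖z‖⁻¹) - 1 where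
  continuousOn := (isSingularKernel_posLog_norm_inv.continuousOn.rexp).sub continuousOn_const
  exists_norm_le := by
    refine ⟨1, fun z _ => ?_⟩
    rw [exp_posLog_of_nonneg (by positivity), one_mul, Real.rpow_neg_one,
      Real.norm_of_nonneg (sub_nonneg.2 (le_max_left _ _)), sub_le_iff_le_add]
    exact max_le (by simp) (by simp)

theorem exp_posLog_sub_one_nonneg (t : ℝ) : 0 ≤ Real.exp (Real.posLog t) - 1 :=
  sub_nonneg.2 (Real.one_le_exp Real.posLog_nonneg)

variable [NormedSpace ℝ E] [FiniteDimensional ℝ E] [MeasurableSpace E] [BorelSpace E]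
  {μ : Measure E} [μ.IsAddHaarMeasure]

theorem integrable_exp_posLog_norm_inv_sub_one (hdim : 2 ≤ Module.finrank ℝ E) :
    Integrable (fun z : E => Real.exp (Real.posLog ‖z‖⁻¹) - 1) μ := by
  have hloc := isSingularKernel_exp_posLog_norm_inv_sub_one.locallyIntegrable (μ := μ)
    zero_le_one (by exact_mod_cast hdim)
  refine (integrableOn_iff_integrable_of_support_subset fun z hz => ?_).1
    (hloc.integrableOn_isCompact (isCompact_closedBall (0 : E) 1))
  contrapose hz
  rw [mem_closedBall_zero_iff, not_le] at hz
  have hz_inv : ‖z‖⁻¹ ≤ 1 := inv_le_one_of_one_le₀ hz.le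
  simp [exp_posLog_of_nonneg, hz_inv]

theorem integrable_integral_mul_exp_posLog_sub_one {f : E → ℝ}
    (hdim : 2 ≤ Module.finrank ℝ E) (hfi : Integrable f μ) :
    Integrable (fun x => ∫ y, f y * (Real.exp (Real.posLog ‖x - y‖⁻¹) - 1) ∂μ) μ :=
  hfi.integrable_convolution (.mul ℝ ℝ) (integrable_exp_posLog_norm_inv_sub_one hdim)

end TruncatedKernel

theorem exists_setIntegral_compl_closedBall_le {α : Type*} [PseudoMetricSpace α]
    [MeasurableSpace α] [OpensMeasurableSpace α] {ν : Measure α} {f : α → ℝ} (hfi : Integrable f ν)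
    (x₀ : α) {ε : ℝ} (hε : 0 < ε) :
    ∃ R ≥ 1, ∫ x in (Metric.closedBall x₀ R)ᶜ, f x ∂ν ≤ ε := by
  have hlim : Tendsto (fun R : ℝ => ∫ x in (Metric.closedBall x₀ R)ᶜ, f x ∂ν) atTop (𝓝 0) := by
    simpa only [setIntegral_compl measurableSet_closedBall hfi, sub_self, id_eq] using
      ((aecover_closedBall tendsto_id).integral_tendsto_of_countably_generated
        hfi).const_sub (∫ x, f x ∂ν)
  obtain ⟨R, hR, hR₁⟩ := ((hlim.eventually_lt_const hε).and (eventually_ge_atTop 1)).exists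
  exact ⟨R, hR₁, hR.le⟩

section LogPotentialDecay

variable {E : Type*} [NormedAddCommGroup E] {R : ℝ} {x y : E}

theorem log_norm_div_norm_sub_le_of_norm_le (hy : y ≠ 0) (hyR : ‖y‖ ≤ R) (hx : 2 * R < ‖x‖) :
    Real.log (‖y‖ / ‖x - y‖) ≤ Real.log (2 * R / ‖x‖) := by
  have := norm_pos_iff.2 hy
  have hxy : ‖x‖ - ‖y‖ ≤ ‖x - y‖ := norm_sub_norm_le x y
  have hxy₀ : 0 < ‖x - y‖ := by linarith
  refine Real.log_le_log (by positivity) ?_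
  rw [div_le_div_iff₀ hxy₀ (by linarith)]
  nlinarith

theorem log_norm_div_norm_sub_le (hx : 1 ≤ ‖x‖) (hy : y ≠ 0) (hxy : y ≠ x) :
    Real.log (‖y‖ / ‖x - y‖) ≤ Real.log (2 * ‖x‖) + Real.posLog ‖x - y‖⁻¹ := by
  have := norm_pos_iff.2 hy
  have hxy₀ : 0 < ‖x - y‖ := norm_pos_iff.2 (sub_ne_zero.2 hxy.symm)
  have htriangle : ‖y‖ ≤ ‖x‖ + ‖x - y‖ := by simpa using norm_sub_le x (x - y)
  rw [Real.log_le_iff_le_exp (by positivity), Real.exp_add, Real.exp_log (by linarith),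
    exp_posLog_of_nonneg (by positivity)]
  calc ‖y‖ / ‖x - y‖ ≤ (‖x‖ + ‖x - y‖) / ‖x - y‖ := by gcongr
    _ = ‖x‖ * ‖x - y‖⁻¹ + 1 * 1 := by field_simp
    _ ≤ ‖x‖ * max 1 ‖x - y‖⁻¹ + ‖x‖ * max 1 ‖x - y‖⁻¹ := by
      gcongr
      exacts [le_max_right _ _, le_max_left _ _]
    _ = 2 * ‖x‖ * max 1 ‖x - y‖⁻¹ := by ring

variable [NormedSpace ℝ E] [FiniteDimensional ℝ E] [MeasurableSpace E] [BorelSpace E]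
  {μ : Measure E} [μ.IsAddHaarMeasure] {f : E → ℝ}

theorem integrable_mul_posLog (hdim : 2 ≤ Module.finrank ℝ E) (hf : Continuous f)
    (hfi : Integrable f μ) (x : E) : Integrable (fun y => f y * Real.posLog ‖x - y‖⁻¹) μ :=
  isSingularKernel_posLog_norm_inv.integrable_smul_sub zero_le_one (by exact_mod_cast hdim)
    hf hfi x

theorem logPotential_le (hdim : 2 ≤ Module.finrank ℝ E) (hf : Continuous f)
    (hfi : Integrable f μ) (hf₀ : ∀ x, 0 ≤ f x) (hR : 1 ≤ R) (hx : 2 * R < ‖x‖) :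
    logPotential μ f x ≤
      Real.log (2 * R / ‖x‖) * ∫ y in Metric.closedBall 0 R, f y ∂μ +
      (Real.log (2 * ‖x‖) * ∫ y in (Metric.closedBall 0 R)ᶜ, f y ∂μ +
        ∫ y in (Metric.closedBall 0 R)ᶜ, f y * Real.posLog ‖x - y‖⁻¹ ∂μ) := by
  have : Nontrivial E := Module.nontrivial_of_finrank_pos (R := ℝ) (by lia)
  have hlog := integrable_log_mul hdim hf hfi x
  have hpos := integrable_mul_posLog hdim hf hfi x
  rw [logPotential,
    ← integral_add_compl (measurableSet_closedBall (x := (0 : E)) (ε := R)) hlog,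
    ← integral_const_mul, ← integral_const_mul,
    ← integral_add (hfi.const_mul _).integrableOn hpos.integrableOn]
  gcongr ?_ + ?_
  · refine setIntegral_mono_on_ae hlog.integrableOn (hfi.const_mul _).integrableOn
      measurableSet_closedBall ?_
    filter_upwards [μ.ae_ne 0] with y hy hyR
    exact mul_le_mul_of_nonneg_right (log_norm_div_norm_sub_le_of_norm_le hy
      (mem_closedBall_zero_iff.1 hyR) hx) (hf₀ y)
  · refine setIntegral_mono_ae hlog.integrableOn ((hfi.const_mul _).add hpos).integrableOn ?_
    filter_upwards [μ.ae_ne 0, μ.ae_ne x] with y hy hxy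
    linear_combination mul_le_mul_of_nonneg_right
      (log_norm_div_norm_sub_le (by linarith) hy hxy) (hf₀ y)

theorem exp_setIntegral_mul_posLog_le (hdim : 2 ≤ Module.finrank ℝ E) (hf : Continuous f)
    (hfi : Integrable f μ) (hf₀ : ∀ x, 0 ≤ f x) {s : Set E} (hs : ∫ y in s, f y ∂μ ≤ 1) (x : E) :
    Real.exp (∫ y in s, f y * Real.posLog ‖x - y‖⁻¹ ∂μ) ≤
      1 + ∫ y, f y * (Real.exp (Real.posLog ‖x - y‖⁻¹) - 1) ∂μ := by
  have hexp : Integrable (fun y => f y * (Real.exp (Real.posLog ‖x - y‖⁻¹) - 1)) μ :=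
    isSingularKernel_exp_posLog_norm_inv_sub_one.integrable_smul_sub zero_le_one
      (by exact_mod_cast hdim) hf hfi x
  refine (exp_integral_mul_le hf₀ hfi.integrableOn hs
    (integrable_mul_posLog hdim hf hfi x).integrableOn hexp.integrableOn).trans ?_
  gcongr 1 + ?_
  exact setIntegral_le_integral hexp
    (ae_of_all _ fun y => mul_nonneg (hf₀ y) (exp_posLog_sub_one_nonneg _))

theorem exp_logPotential_le (hdim : 2 ≤ Module.finrank ℝ E) (hf : Continuous f)
    (hfi : Integrable f μ) (hf₀ : ∀ x, 0 ≤ f x) (hR : 1 ≤ R) (hx : 2 * R < ‖x‖)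
    (hfar : ∫ y in (Metric.closedBall 0 R)ᶜ, f y ∂μ ≤ 1) :
    Real.exp (logPotential μ f x) ≤
      (2 * R) ^ (∫ y in Metric.closedBall 0 R, f y ∂μ) *
        2 ^ (∫ y in (Metric.closedBall 0 R)ᶜ, f y ∂μ) *
        ‖x‖ ^ (∫ y in (Metric.closedBall 0 R)ᶜ, f y ∂μ - ∫ y in Metric.closedBall 0 R, f y ∂μ) *
        (1 + ∫ y, f y * (Real.exp (Real.posLog ‖x - y‖⁻¹) - 1) ∂μ) := by
  have hR₀ : 0 < 2 * R := by linarith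
  have hx₀ : 0 < ‖x‖ := by linarith
  refine (Real.exp_le_exp.2 (logPotential_le hdim hf hfi hf₀ hR hx)).trans ?_
  rw [Real.exp_add, Real.exp_add, ← Real.rpow_def_of_pos (by positivity),
    ← Real.rpow_def_of_pos (by positivity), Real.div_rpow hR₀.le hx₀.le,
    Real.mul_rpow zero_le_two hx₀.le, Real.rpow_sub hx₀, ← mul_assoc]
  refine (mul_le_mul_of_nonneg_left (exp_setIntegral_mul_posLog_le hdim hf hfi hf₀ hfar x)
    (by positivity)).trans_eq ?_
  ring

theorem integrableOn_norm_rpow_mul (hdim : 0 < Module.finrank ℝ E) {p : ℝ} (hp : p < -1)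
    (hR : 0 < R) :
    IntegrableOn (fun x : E => ‖x‖ ^ p * (‖x‖ ^ (Module.finrank ℝ E - 1))⁻¹)
      (Metric.closedBall 0 R)ᶜ μ := by
  have : Nontrivial E := Module.nontrivial_of_finrank_pos (R := ℝ) hdim
  have hradial : IntegrableOn ((Set.Ioi R).indicator fun r : ℝ => r ^ p) (Set.Ioi 0) :=
    ((integrableOn_Ioi_rpow_of_lt hp hR).integrable_indicator measurableSet_Ioi).integrableOn
  rw [← integrable_indicator_iff measurableSet_closedBall.compl]
  refine ((integrable_fun_norm_addHaar μ (f := (Set.Ioi R).indicator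
    fun r : ℝ => r ^ p * (r ^ (Module.finrank ℝ E - 1))⁻¹)).2 ?_).congr
      (ae_of_all _ fun x => by simp [Set.indicator])
  refine hradial.congr_fun (fun r (hr : 0 < r) => ?_) measurableSet_Ioi
  by_cases hrR : r ∈ Set.Ioi R
  · simp only [Set.indicator_of_mem hrR, smul_eq_mul]
    field_simp
  · simp only [Set.indicator_of_notMem hrR, smul_zero]

theorem integrableOn_exp_logPotential_mul (hdim : 2 ≤ Module.finrank ℝ E) (hf : Continuous f)
    (hfi : Integrable f μ) (hf₀ : ∀ x, 0 ≤ f x) (hR : 1 ≤ R)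
    (hfar : ∫ y in (Metric.closedBall 0 R)ᶜ, f y ∂μ ≤ 1)
    (hnear : 1 < ∫ y in Metric.closedBall 0 R, f y ∂μ - ∫ y in (Metric.closedBall 0 R)ᶜ, f y ∂μ) :
    IntegrableOn (fun x => Real.exp (logPotential μ f x) * (‖x‖ ^ (Module.finrank ℝ E - 1))⁻¹)
      (Metric.closedBall 0 (2 * R))ᶜ μ := by
  set near := ∫ y in Metric.closedBall 0 R, f y ∂μ
  set far := ∫ y in (Metric.closedBall 0 R)ᶜ, f y ∂μ
  set K : ℝ := (2 * R) ^ near * 2 ^ far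
  set H : E → ℝ := fun x => ∫ y, f y * (Real.exp (Real.posLog ‖x - y‖⁻¹) - 1) ∂μ
  set w : E → ℝ := fun x => ‖x‖ ^ (far - near) * (‖x‖ ^ (Module.finrank ℝ E - 1))⁻¹
  have hdom : IntegrableOn (fun x => K * (w x + H x)) (Metric.closedBall 0 (2 * R))ᶜ μ :=
    ((integrableOn_norm_rpow_mul (by lia) (by linarith) (by linarith)).add
      (integrable_integral_mul_exp_posLog_sub_one hdim hfi).integrableOn).const_mul K
  have hmeas : StronglyMeasurable (logPotential μ f) :=
    StronglyMeasurable.integral_prod_right' (f := fun p : E × E =>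
      Real.log (‖p.2‖ / ‖p.1 - p.2‖) * f p.2) (Measurable.stronglyMeasurable (by fun_prop))
  refine hdom.mono' (by fun_prop) ?_
  filter_upwards [ae_restrict_mem measurableSet_closedBall.compl] with x hx
  have hxR : 2 * R < ‖x‖ := by simpa using hx
  have hH : 0 ≤ H x :=
    integral_nonneg fun y => mul_nonneg (hf₀ y) (exp_posLog_sub_one_nonneg _)
  have hw : w x ≤ 1 :=
    mul_le_one₀ (Real.rpow_le_one_of_one_le_of_nonpos (by linarith) (by linarith))
      (by positivity) (inv_le_one_of_one_le₀ (one_le_pow₀ (by linarith)))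
  rw [Real.norm_of_nonneg (by positivity)]
  calc Real.exp (logPotential μ f x) * (‖x‖ ^ (Module.finrank ℝ E - 1))⁻¹
      ≤ K * ‖x‖ ^ (far - near) * (1 + H x) * (‖x‖ ^ (Module.finrank ℝ E - 1))⁻¹ := by
        gcongr
        exact exp_logPotential_le hdim hf hfi hf₀ hR hxR hfar
    _ = K * (w x + w x * H x) := by ring
    _ ≤ K * (w x + H x) := by
        gcongr
        exact mul_le_of_le_one_left hH hw

end LogPotentialDecay

section TotalMass

variable {n : ℕ}

theorem lintegral_exp_mul_eq_top (hn : 0 < n) {u : EuclideanSpace ℝ (Fin n) → ℝ}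
    (hu : Continuous u) (hg : IsCompleteMetric (conformalMetric u)) {R : ℝ} (hR : 0 ≤ R) :
    ∫⁻ x in (Metric.closedBall 0 R)ᶜ,
      ENNReal.ofReal (Real.exp (u x) * (‖x‖ ^ (n - 1))⁻¹) = ⊤ := by
  have : Nontrivial (EuclideanSpace ℝ (Fin n)) :=
    Module.nontrivial_of_finrank_pos (R := ℝ) (by simpa)
  have hmeas : Measurable fun x => ENNReal.ofReal (Real.exp (u x) * (‖x‖ ^ (n - 1))⁻¹) := by
    fun_prop
  have hball : MeasurableSet (Metric.closedBall (0 : EuclideanSpace ℝ (Fin n)) R)ᶜ :=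
    measurableSet_closedBall.compl
  rw [← lintegral_indicator hball, lintegral_eq_lintegral_toSphere _ (hmeas.indicator hball)]
  have hray (θ : Metric.sphere (0 : EuclideanSpace ℝ (Fin n)) 1) :
      ∫⁻ r in Set.Ioi (0 : ℝ),
        ENNReal.ofReal (r ^ (Module.finrank ℝ (EuclideanSpace ℝ (Fin n)) - 1)) *
          (Metric.closedBall 0 R)ᶜ.indicator
            (fun x => ENNReal.ofReal (Real.exp (u x) * (‖x‖ ^ (n - 1))⁻¹))
            (r • (θ : EuclideanSpace ℝ (Fin n))) = ⊤ := by
    have hθ : ‖(θ : EuclideanSpace ℝ (Fin n))‖ = 1 := norm_eq_of_mem_sphere θ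
    rw [← top_le_iff, ← lintegral_ray_eq_top hu hg hθ R]
    refine (setLIntegral_mono' measurableSet_Ioi fun r (hr : R < r) => ?_).trans
      (lintegral_mono_set (Set.Ioi_subset_Ioi hR))
    have hr₀ : 0 < r := hR.trans_lt hr
    have hnorm : ‖r • (θ : EuclideanSpace ℝ (Fin n))‖ = r := by
      rw [norm_smul, hθ, mul_one, Real.norm_of_nonneg hr₀.le]
    rw [Set.indicator_of_mem (by simpa [hnorm] using hr), ← ENNReal.ofReal_mul (by positivity),
      hnorm, finrank_euclideanSpace_fin]
    exact ENNReal.ofReal_le_ofReal (le_of_eq (by field_simp))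
  simp only [hray, lintegral_const]
  exact ENNReal.top_mul (Measure.measure_univ_ne_zero.2 (Measure.toSphere_ne_zero _))

theorem integral_le_one_of_isCompleteMetric (hn : 2 ≤ n) {f : EuclideanSpace ℝ (Fin n) → ℝ}
    (hf : Continuous f) (hfi : Integrable f) (hf₀ : ∀ x, 0 ≤ f x) {C : ℝ}
    (hg : IsCompleteMetric (conformalMetric fun x => logPotential volume f x + C)) :
    ∫ x, f x ≤ 1 := by
  have hdim : 2 ≤ Module.finrank ℝ (EuclideanSpace ℝ (Fin n)) := by simpa
  have hcont : Continuous (logPotential volume f) :=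
    continuous_iff_continuousAt.2 fun x => (hasFDerivAt_logPotential hdim hf hfi x).continuousAt
  by_contra! hmass
  obtain ⟨R, hR, hfar⟩ := exists_setIntegral_compl_closedBall_le hfi 0
    (ε := min 1 (((∫ x, f x) - 1) / 3)) (by simpa)
  obtain ⟨hfar₁, hfar₂⟩ := le_min_iff.1 hfar
  have hsplit := integral_add_compl
    (measurableSet_closedBall (x := (0 : EuclideanSpace ℝ (Fin n))) (ε := R)) hfi
  have hint := integrableOn_exp_logPotential_mul hdim hf hfi hf₀ hR hfar₁ (by linarith)
  refine (hint.const_mul (Real.exp C)).lintegral_lt_top.ne ?_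
  have htop := lintegral_exp_mul_eq_top (u := fun x => logPotential volume f x + C)
    (by lia) (hcont.add continuous_const) hg (R := 2 * R) (by linarith)
  simpa only [finrank_euclideanSpace_fin, Real.exp_add, mul_comm (Real.exp C), mul_right_comm]
    using htop

end TotalMass

section NormalMetric

variable {n : ℕ} {u : EuclideanSpace ℝ (Fin n) → ℝ}

/-- The density `2 / ((n-1)! |𝕊ⁿ|) Q e^{nu}` of total Q-curvature, normalized so that a normal
metric is the one whose `u` is its logarithmic potential up to a constant. -/
def normalizedQDensity (u : EuclideanSpace ℝ (Fin n) → ℝ) (x : EuclideanSpace ℝ (Fin n)) : ℝ :=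
  2 / ((Nat.factorial (n - 1) : ℝ) * unitSphereArea (n + 1)) *
    (qCurvature u x * Real.exp (n * u x))

theorem qCurvature_mul_exp (u : EuclideanSpace ℝ (Fin n) → ℝ) (x : EuclideanSpace ℝ (Fin n)) :
    qCurvature u x * Real.exp (n * u x) = negLaplacianPow (n / 2) u x := by
  rw [qCurvature, mul_right_comm, ← Real.exp_add, neg_add_cancel, Real.exp_zero, one_mul]

theorem continuous_normalizedQDensity (hu : ContDiff ℝ ∞ u) :
    Continuous (normalizedQDensity u) := by
  unfold normalizedQDensity
  simp only [qCurvature_mul_exp]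
  exact (contDiff_negLaplacianPow hu _).continuous.const_mul _

theorem normalizedQDensity_nonneg (hQ : ∀ x, 0 ≤ qCurvature u x)
    (x : EuclideanSpace ℝ (Fin n)) : 0 ≤ normalizedQDensity u x := by
  have := unitSphereArea_pos n.succ_pos
  have := hQ x
  unfold normalizedQDensity
  positivity

theorem HasFiniteTotalQ.integrable_normalizedQDensity (hu : HasFiniteTotalQ u) :
    Integrable (normalizedQDensity u) :=
  hu.const_mul _

theorem IsNormal.exists_eq_logPotential_add (hu : IsNormal u) :
    ∃ C, ∀ x, u x = logPotential volume (normalizedQDensity u) x + C := by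
  obtain ⟨C, hC⟩ := hu
  refine ⟨C, fun x => (hC x).trans ?_⟩
  rw [logPotential, ← integral_const_mul]
  simp only [normalizedQDensity, mul_left_comm]

theorem logPotential_eq_zero_of_integral_eq_zero {f : EuclideanSpace ℝ (Fin n) → ℝ}
    (hf₀ : ∀ x, 0 ≤ f x) (hfi : Integrable f) (hzero : ∫ x, f x = 0)
    (x : EuclideanSpace ℝ (Fin n)) : logPotential volume f x = 0 := by
  have hae : f =ᵐ[volume] 0 := (integral_eq_zero_iff_of_nonneg hf₀ hfi).1 hzero
  exact integral_eq_zero_of_ae <| hae.mono fun y hy => mul_eq_zero_of_right _ hy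

end NormalMetric

end ConformalMass

end

theorem mainTheorem9_general {n : ℕ} (hn : 3 ≤ n) {u f : EuclideanSpace ℝ (Fin n) → ℝ} {C : ℝ}
    (hu : ∀ x, u x = ConformalMass.logPotential volume f x + C)
    (hf : Continuous f) (hfi : Integrable f) (hf₀ : ∀ x, 0 ≤ f x)
    (h_complete : ConformalMass.IsCompleteMetric (ConformalMass.conformalMetric u)) :
    0 ≤ ConformalMass.conformalMass u ∧
      (ConformalMass.conformalMass u = 0 ↔ ∃ c : ℝ, ∀ x, u x = c) := by
  obtain rfl := funext hu
  have hα_nonneg : 0 ≤ ∫ x, f x := integral_nonneg hf₀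
  have hα_le : ∫ x, f x ≤ 1 :=
    ConformalMass.integral_le_one_of_isCompleteMetric (by lia) hf hfi hf₀ h_complete
  have hmass := ConformalMass.le_conformalMass_logPotential hn hf hfi hf₀ (by linarith) C
  refine ⟨le_trans (EReal.coe_nonneg.2 (mul_nonneg (by linarith) hα_nonneg)) hmass,
    fun hzero => ?_, ?_⟩
  · have hprod : (2 - ∫ x, f x) * ∫ x, f x ≤ 0 := by
      rw [hzero] at hmass
      exact_mod_cast hmass
    have hα : ∫ x, f x = 0 := by nlinarith
    have hpotential := ConformalMass.logPotential_eq_zero_of_integral_eq_zero hf₀ hfi hα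
    exact ⟨C, fun x => (hu x).trans (by rw [hpotential, zero_add])⟩
  · rintro ⟨c, hc⟩
    rw [funext hc, ConformalMass.conformalMass_const]

theorem mainTheorem9 (n : ℕ) (hn : 4 ≤ n) (hn_even : Even n)
    (u : EuclideanSpace ℝ (Fin n) → ℝ) (hu : ContDiff ℝ ∞ u)
    (h_complete : ConformalMass.IsCompleteMetric (ConformalMass.conformalMetric u))
    (h_finite : ConformalMass.HasFiniteTotalQ u)
    (h_normal : ConformalMass.IsNormal u)
    (hQ : ∀ x, 0 ≤ ConformalMass.qCurvature u x) :
    0 ≤ ConformalMass.conformalMass u ∧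
      (ConformalMass.conformalMass u = 0 ↔ ∃ c : ℝ, ∀ x, u x = c) := by
  obtain ⟨C, hC⟩ := h_normal.exists_eq_logPotential_add
  exact mainTheorem9_general (by lia) hC (ConformalMass.continuous_normalizedQDensity hu)
    h_finite.integrable_normalizedQDensity (ConformalMass.normalizedQDensity_nonneg hQ) h_complete
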